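/- **Setting.** Let $(\mathbb K,|\cdot|)$ be a field with an absolute value defining a non-discrete, locally compact topology, and assume that $\mathbb K$ is not isomorphic to $\mathbb C$ as a topological field. Let $E\neq\{0\}$ be a finite-dimensional $\mathbb K$-vector space, $A\colon E\to E$ a linear automorphism and $E=E_s\oplus E_u$ a decomposition into $A$-invariant subspaces. Let $\|\cdot\|$ be a norm on $E$ adapted to $A$, that is, $\|x+y\|=\max\{\|x\|,\|y\|\}$ for $x\in E_s$, $y\in E_u$, and $a_s:=\|A|_{E_s}\|<1$, $a_u:=\|A^{-1}|_{E_u}\|<1$. If $|\cdot|$ is ultrametric, assume that $\|\cdot\|$ is ultrametric. Write $B_t(0)$ for the open ball of radius $t$ in $(E,\|\cdot\|)$, put $m:=\|A^{-1}\|^{-1}$, and let $\alpha\in\,]0,1[$ and $\varepsilon,\delta>0$ be such that $\delta<m$, $a_u(1+\delta)<1$, $a_s+\delta<1$, $$2a_u\delta+\varepsilon a_u(\|A\|+\delta)^\alpha+a_u\max\{\delta(1+\varepsilon),2\delta\}\le\varepsilon,$$ $$\frac{\varepsilon a_s}{(m-\delta)^\alpha}+\max\Big\{\frac{\delta}{m-\delta},2\delta\Big\}+\frac{\max\{\delta(1+\varepsilon),2\delta\}}{(m-\delta)^\alpha}\le\varepsilon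 .$$ Let $P\subseteq E$ be an open $0$-neighbourhood and $r>0$ be such that the closure of $K:=B_r(0)$ is contained in $P$. If $|\cdot|$ is not ultrametric, put $s:=r/3$ and fix $L\ge 0$ and a function $\xi\colon E\to\mathbb K$ with $|\xi|\le 1$, $\xi(y)=1$ if $\|y\|\le s$, $\xi(y)=0$ if $\|y\|\ge 2s$, and $|\xi(y)-\xi(z)|\le\frac Ls\|y-z\|$ for all $y,z\in E$. (If $\mathbb K=\mathbb R$ with its usual absolute value, one may take $\xi(y)=\eta(\|y\|/s)$ with a Lipschitz function $\eta\colon[0,\infty[\,\to[0,1]$, $\eta=1$ on $[0,1]$, $\eta=0$ on $[2,\infty[$, and $L=\mathrm{Lip}(\eta)$.) Let $\tilde\Omega$ be the set of all $f\colon B_r(0)\to E$ which are strictly differentiable at $0$ with $f(0)=0$, $f'(0)=A$, and such that $R_f:=f-A$ is Lipschitz with $\mathrm{Lip}(R_f)\le\delta$ if $|\cdot|$ is ultrametric, and $\mathrm{Lip}(R_f)\le\delta/(1+3L)$ otherwise. For $f\in\tilde\Omega$ let $g_f\colon E\to E$ vanish outside $B_r(0)$ and be equal on $B_r(0)$ to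 $R_f$ (ultrametric case), respectively to $\xi R_f$ (otherwise). Let $BC(E,E)$ be the space of bounded continuous maps with the supremum metric $d_\infty$ (this symbol is also used for the supremum metric on $\tilde\Omega$). Let $\tilde v_f\in BC(E,E)$ be the bounded continuous map determined by $(A+g_f)\circ(\mathrm{id}_E+\tilde v_f)=(\mathrm{id}_E+\tilde v_f)\circ A$, and $\tilde w_f:=(\mathrm{id}_E+\tilde v_f)^{-1}-\mathrm{id}_E$. A map $g\colon P\to E$ is $C^1$ if $(x,y,t)\mapsto t^{-1}(g(x+ty)-g(x))$, $t\ne0$, extends to a continuous map $g^{[1]}$ on $P^{[1]}:=\{(x,y,t)\in P\times E\times\mathbb K: x+ty\in P\}$. The compact-open $C^1$-topology on $C^1(P,E)$ is the initial topology with respect to $g\mapsto g\in C(P,E)$ and $g\mapsto g^{[1]}\in C(P^{[1]},E)$, with the compact-open topologies on the targets. Give $C^1_{**}(P,E):=\{g\in C^1(P,E): g(0)=0,\ g'(0)=0\}$ the induced topology, and let $d_K(g,h):=\sup_{x\in K}\|g(x)-h(x)\|$. For $\beta>0$ let $BL_\beta(B_t(0),E)$ be the space of bounded Hölder maps of exponent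 $\beta$, with the norm $\max\{\|\cdot\|_\infty,\mathrm{Lip}_\beta(\cdot)\}$. **Proposition.** Let $$\Omega:=\{g\in C^1_{**}(P,E): A+g|_{B_r(0)}\in\tilde\Omega\},\qquad \Lambda(g):=A+g|_{B_r(0)} .$$ 1. $\Omega$ is a $0$-neighbourhood in $C^1_{**}(P,E)$ for the compact-open $C^1$-topology. 2. For $g\in\Omega$ and $f:=\Lambda(g)$, the map $\tilde v_f\in BC(E,E)$ exists and is unique, $\mathrm{id}_E+\tilde v_f$ is bijective, and $\tilde w_f\in BC(E,E)$. 3. $\Lambda\colon(\Omega,d_K)\to(\tilde\Omega,d_\infty)$ is Lipschitz with $\mathrm{Lip}(\Lambda)\le1$. 4. $g\mapsto\tilde v_{\Lambda(g)}$ is Lipschitz from $(\Omega,d_K)$ to $(BC(E,E),d_\infty)$, and $g\mapsto\tilde w_{\Lambda(g)}$ is Hölder of exponent $\alpha$ from $(\Omega,d_K)$ to $(BC(E,E),d_\infty)$. 5. For all $t>0$ and $0<\beta<\alpha$, the maps $g\mapsto\tilde v_{\Lambda(g)}|_{B_t(0)}$ and $g\mapsto\tilde w_{\Lambda(g)}|_{B_t(0)}$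 take values in $BL_\beta(B_t(0),E)$ and are continuous from $(\Omega,d_K)$ to $BL_\beta(B_t(0),E)$. -/

import Mathlib

open scoped NNReal ENNReal Topology BoundedContinuousFunction

namespace GrobmanHartman

/-! ## Distances, Lipschitz and Hölder maps -/

section Distances

/-- The supremum distance `sup_x ‖u x - v x‖`. -/
noncomputable def supEDist {X E : Type*} [PseudoEMetricSpace E] (u v : X → E) : ℝ≥0∞ :=
  ⨆ x, edist (u x) (v x)

/-- `F` is Hölder of exponent `a` on `S`, for given pseudometrics on the source and target. -/
def IsHolderOn {X Y : Type*} (dX : X → X → ℝ≥0∞) (dY : Y → Y → ℝ≥0∞) (a : ℝ≥0)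
    (F : X → Y) (S : Set X) : Prop :=
  ∃ C : ℝ≥0, ∀ g ∈ S, ∀ h ∈ S, dY (F g) (F h) ≤ C * dX g h ^ (a : ℝ)

/-- `F` is continuous on `S`, for given pseudometrics on the source and target. -/
def IsContOn {X Y : Type*} (dX : X → X → ℝ≥0∞) (dY : Y → Y → ℝ≥0∞)
    (F : X → Y) (S : Set X) : Prop :=
  ∀ g ∈ S, ∀ e : ℝ≥0∞, 0 < e → ∃ d : ℝ≥0∞, 0 < d ∧
    ∀ h ∈ S, dX g h < d → dY (F g) (F h) < e

/-- Membership in `BL_b(X, E)`: bounded, continuous, and Hölder of exponent `b`. -/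
def MemBL {X E : Type*} [MetricSpace X] [NormedAddCommGroup E] (b : ℝ≥0) (u : X → E) : Prop :=
  Continuous u ∧ (∃ M : ℝ, ∀ x, ‖u x‖ ≤ M) ∧ MemHolder b u

/-- The norm `‖u‖_b = max (‖u‖_∞) (Lip_b u)` of `BL_b(X, E)`; here `eHolderNorm b u` is the
smallest Hölder constant of exponent `b`. -/
noncomputable def blNorm {X E : Type*} [MetricSpace X] [NormedAddCommGroup E] (b : ℝ≥0)
    (u : X → E) : ℝ≥0∞ :=
  max (⨆ x, ‖u x‖ₑ) (eHolderNorm b u)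

end Distances

section Main

variable {𝕜 E : Type*} [NontriviallyNormedField 𝕜] [NormedAddCommGroup E] [NormedSpace 𝕜 E]

/-! ## Strict differentiability and `C¹`-maps over valued fields -/

/-- `f : U → E` is strictly differentiable at `x ∈ U` with derivative `L`. -/
def HasStrictDeriv {U : Set E} (f : U → E) (L : E →L[𝕜] E) (x : U) : Prop :=
  (fun p : U × U => f p.1 - f p.2 - L ((p.1 : E) - (p.2 : E)))
    =o[𝓝 (x, x)] fun p : U × U => (p.1 : E) - (p.2 : E)

/-- The domain `U^[1] = {(x, y, t) | x ∈ U, x + t y ∈ U}` of the difference quotient. -/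
def dqDomain (𝕜 : Type*) {E : Type*} [NontriviallyNormedField 𝕜] [NormedAddCommGroup E]
    [NormedSpace 𝕜 E] (U : Set E) : Set (E × E × 𝕜) :=
  {p | p.1 ∈ U ∧ p.1 + p.2.2 • p.2.1 ∈ U}

/-- `F` extends the difference quotient `(x, y, t) ↦ t⁻¹ (f (x + t y) - f x)`, `t ≠ 0`. -/
def ExtendsDQ {U : Set E} (f : U → E) (F : dqDomain 𝕜 U → E) : Prop :=
  ∀ p : dqDomain 𝕜 U, p.1.2.2 ≠ 0 →
    F p = p.1.2.2⁻¹ • (f ⟨p.1.1 + p.1.2.2 • p.1.2.1, p.2.2⟩ - f ⟨p.1.1, p.2.1⟩)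

/-- The set `C¹(U, E)`: the difference quotient of `f` extends continuously to `U^[1]`. -/
structure C1Map (𝕜 : Type*) {E : Type*} [NontriviallyNormedField 𝕜] [NormedAddCommGroup E]
    [NormedSpace 𝕜 E] (U : Set E) where
  toMap : C(U, E)
  exists_dq : ∃ F : C(dqDomain 𝕜 U, E), ExtendsDQ (𝕜 := 𝕜) toMap F

/-- The map `f^[1]` (it is unique if `U` is open). -/
noncomputable def C1Map.dq {U : Set E} (f : C1Map 𝕜 U) : C(dqDomain 𝕜 U, E) :=
  f.exists_dq.choose

/-- The compact-open `C¹`-topology: the initial topology with respect to `f ↦ f` and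
`f ↦ f^[1]`, where spaces of continuous maps carry the compact-open topology. -/
noncomputable instance {U : Set E} : TopologicalSpace (C1Map 𝕜 U) :=
  TopologicalSpace.induced C1Map.toMap inferInstance ⊓
    TopologicalSpace.induced C1Map.dq inferInstance

instance {U : Set E} : Zero (C1Map 𝕜 U) :=
  ⟨⟨0, 0, fun p _ => by simp⟩⟩

/-- The space of all `g ∈ C¹(P, E)` with `g 0 = 0` and `g' 0 = 0`, with the topology induced by
the compact-open `C¹`-topology. -/
abbrev C1Zero (𝕜 : Type*) {E : Type*} [NontriviallyNormedField 𝕜] [NormedAddCommGroup E]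
    [NormedSpace 𝕜 E] (P : Set E) (h0 : (0 : E) ∈ P) : Type _ :=
  {g : C1Map 𝕜 P // g.toMap ⟨0, h0⟩ = 0 ∧ HasStrictDeriv g.toMap (0 : E →L[𝕜] E) ⟨0, h0⟩}

instance (P : Set E) (h0 : (0 : E) ∈ P) : Zero (C1Zero 𝕜 P h0) :=
  ⟨⟨0, rfl, by
    have h : (fun p : P × P => ((0 : C1Map 𝕜 P).toMap p.1 - (0 : C1Map 𝕜 P).toMap p.2
        - (0 : E →L[𝕜] E) ((p.1 : E) - (p.2 : E)))) = fun _ => (0 : E) := by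
      funext p
      change (0 : E) - 0 - 0 = 0
      simp
    unfold HasStrictDeriv
    rw [h]
    exact Asymptotics.isLittleO_zero _ _⟩⟩

/-- The restriction of `g : P → E` to the open ball `B_r(0)`. -/
def restrictBall {P : Set E} {h0 : (0 : E) ∈ P} {r : ℝ} (hrP : Metric.ball (0 : E) r ⊆ P)
    (g : C1Zero 𝕜 P h0) : Metric.ball (0 : E) r → E :=
  fun x => g.1.toMap ⟨x, hrP x.2⟩

/-- The pseudometric `d_K(g, h) = sup_{x ∈ K} ‖g x - h x‖` for `K = B_r(0)`. -/
noncomputable def dK {P : Set E} {h0 : (0 : E) ∈ P} {r : ℝ} (hrP : Metric.ball (0 : E) r ⊆ P)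
    (g h : C1Zero 𝕜 P h0) : ℝ≥0∞ :=
  supEDist (restrictBall hrP g) (restrictBall hrP h)

/-! ## Hyperbolic automorphisms and the constants -/

/-- The operator norm of `A|_{E_s}`. -/
noncomputable def stableNorm (A : E ≃L[𝕜] E) (Es : Submodule 𝕜 E) : ℝ :=
  ‖(A : E →L[𝕜] E).comp Es.subtypeL‖

/-- The operator norm of `A⁻¹|_{E_u}`. -/
noncomputable def unstableNorm (A : E ≃L[𝕜] E) (Eu : Submodule 𝕜 E) : ℝ :=
  ‖(A.symm : E →L[𝕜] E).comp Eu.subtypeL‖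

/-- `A` is hyperbolic with stable subspace `Es` and unstable subspace `Eu`, and the given norm
of `E` is adapted to `A`. -/
structure IsAdapted (A : E ≃L[𝕜] E) (Es Eu : Submodule 𝕜 E) : Prop where
  isCompl : IsCompl Es Eu
  stable_invariant : ∀ x ∈ Es, A x ∈ Es
  unstable_invariant : ∀ x ∈ Eu, A x ∈ Eu
  norm_add : ∀ x ∈ Es, ∀ y ∈ Eu, ‖x + y‖ = max ‖x‖ ‖y‖
  stable_lt_one : stableNorm A Es < 1
  unstable_lt_one : unstableNorm A Eu < 1

/-- The smallness conditions relating `a` (the Hölder exponent), `ε` and `δ`. -/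
structure Admissible (A : E ≃L[𝕜] E) (Es Eu : Submodule 𝕜 E) (a ε δ : ℝ≥0) : Prop where
  exp_pos : 0 < a
  exp_lt_one : a < 1
  eps_pos : 0 < ε
  delta_pos : 0 < δ
  delta_lt : (δ : ℝ) < ‖(A.symm : E →L[𝕜] E)‖⁻¹
  unstable_lt : unstableNorm A Eu * (1 + δ) < 1
  stable_lt : stableNorm A Es + δ < 1
  unstable_le : 2 * unstableNorm A Eu * δ
      + ε * unstableNorm A Eu * (‖(A : E →L[𝕜] E)‖ + δ) ^ (a : ℝ)
      + unstableNorm A Eu * max ((δ : ℝ) * (1 + ε)) (2 * δ) ≤ ε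
  stable_le : ε * stableNorm A Es / (‖(A.symm : E →L[𝕜] E)‖⁻¹ - δ) ^ (a : ℝ)
      + max ((δ : ℝ) / (‖(A.symm : E →L[𝕜] E)‖⁻¹ - δ)) (2 * δ)
      + max ((δ : ℝ) * (1 + ε)) (2 * δ) / (‖(A.symm : E →L[𝕜] E)‖⁻¹ - δ) ^ (a : ℝ) ≤ ε

/-! ## Cutting off the nonlinearity -/

/-- A cut-off function at scale `s`, Lipschitz with constant `L / s` as a map to the valued
field `𝕜`. -/
structure IsCutoff (s : ℝ) (L : ℝ≥0) (ξ : E → 𝕜) : Prop where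
  norm_le_one : ∀ y, ‖ξ y‖ ≤ 1
  eq_one : ∀ y, ‖y‖ ≤ s → ξ y = 1
  eq_zero : ∀ y, 2 * s ≤ ‖y‖ → ξ y = 0
  lipschitz : ∀ y z, ‖ξ y - ξ z‖ ≤ L / s * ‖y - z‖

/-- Over `ℝ` with its usual absolute value, the usual radial cut-off is an example. -/
theorem isCutoff_radial {F : Type*} [NormedAddCommGroup F] [NormedSpace ℝ F]
    {η : ℝ → ℝ} {L : ℝ≥0} (hL : LipschitzOnWith L η (Set.Ici 0))
    (h01 : ∀ t, 0 ≤ t → η t ∈ Set.Icc (0 : ℝ) 1) (h1 : ∀ t, 0 ≤ t → t ≤ 1 → η t = 1)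
    (h2 : ∀ t, 2 ≤ t → η t = 0) {s : ℝ} (hs : 0 < s) :
    IsCutoff (𝕜 := ℝ) s L (fun y : F => η (‖y‖ / s)) where
  norm_le_one y := by
    have h := h01 (‖y‖ / s) (by positivity)
    rw [Real.norm_eq_abs, abs_of_nonneg h.1]
    exact h.2
  eq_one y hy := h1 _ (by positivity) ((div_le_one hs).2 hy)
  eq_zero y hy := h2 _ ((le_div_iff₀ hs).2 hy)
  lipschitz y z := by
    have hy : ‖y‖ / s ∈ Set.Ici (0 : ℝ) := by simp only [Set.mem_Ici]; positivity
    have hz : ‖z‖ / s ∈ Set.Ici (0 : ℝ) := by simp only [Set.mem_Ici]; positivity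
    have h := hL.dist_le_mul _ hy _ hz
    rw [Real.dist_eq, Real.dist_eq, ← sub_div, abs_div, abs_of_pos hs] at h
    rw [Real.norm_eq_abs]
    refine h.trans ?_
    rw [div_mul_eq_mul_div, mul_div_assoc]
    have := abs_norm_sub_norm_le y z
    gcongr

open Classical in
/-- The bound imposed on the Lipschitz constant of the nonlinearity: `δ` if `𝕜` is ultrametric,
and `δ / (1 + 3 L)` otherwise. -/
noncomputable def lipBound (𝕜 : Type*) [NontriviallyNormedField 𝕜] (δ L : ℝ≥0) : ℝ≥0 :=
  if IsUltrametricDist 𝕜 then δ else δ / (1 + 3 * L)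

open Classical in
/-- The extension to `E` of a nonlinearity `R : B_r(0) → E`: by zero if `𝕜` is ultrametric, and
after multiplication with `ξ` otherwise. -/
noncomputable def cutExtend (r : ℝ) (ξ : E → 𝕜) (R : Metric.ball (0 : E) r → E) : E → E :=
  fun y => if hy : y ∈ Metric.ball (0 : E) r then
    (if IsUltrametricDist 𝕜 then R ⟨y, hy⟩ else ξ y • R ⟨y, hy⟩) else 0

/-- The nonlinearity `f - A` of `f : B_r(0) → E`. -/
def remainder (A : E ≃L[𝕜] E) {r : ℝ} (f : Metric.ball (0 : E) r → E) :
    Metric.ball (0 : E) r → E :=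
  fun x => f x - A x

/-- The set of all `f : B_r(0) → E` which are strictly differentiable at `0` with `f 0 = 0` and
`f' 0 = A`, and whose nonlinearity is Lipschitz with sufficiently small constant. -/
def tildeOmega (A : E ≃L[𝕜] E) (δ L : ℝ≥0) {r : ℝ} (hr : 0 < r) :
    Set (Metric.ball (0 : E) r → E) :=
  {f | HasStrictDeriv f (A : E →L[𝕜] E) ⟨0, Metric.mem_ball_self hr⟩ ∧
    f ⟨0, Metric.mem_ball_self hr⟩ = 0 ∧ LipschitzWith (lipBound 𝕜 δ L) (remainder A f)}

/-! ## The conjugacies -/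

/-- `(A + g) ∘ (id + v) = (id + v) ∘ A`. -/
def IsConj (A : E ≃L[𝕜] E) (g : E → E) (v : E →ᵇ E) : Prop :=
  ∀ x, A (x + v x) + g (x + v x) = A x + v (A x)

/-- `id + w` is a two-sided inverse of `id + v`. -/
def IsInv (v w : E →ᵇ E) : Prop :=
  (∀ x, (x + w x) + v (x + w x) = x) ∧ ∀ x, (x + v x) + w (x + v x) = x

open Classical in
/-- The bounded continuous map `v_g` determined by `(A + g) ∘ (id + v_g) = (id + v_g) ∘ A`. -/
noncomputable def sigma (A : E ≃L[𝕜] E) (g : E → E) : E →ᵇ E :=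
  if h : ∃! v : E →ᵇ E, IsConj A g v then h.exists.choose else 0

open Classical in
/-- The bounded continuous map `w_g = (id + v_g)⁻¹ - id`. -/
noncomputable def tau (A : E ≃L[𝕜] E) (g : E → E) : E →ᵇ E :=
  if h : ∃ w : E →ᵇ E, IsInv (sigma A g) w then h.choose else 0

/-- `f ↦ v_{g_f}`, where `g_f` is the cut-off nonlinearity of `f`. -/
noncomputable def sigmaTilde (A : E ≃L[𝕜] E) {r : ℝ} (ξ : E → 𝕜)
    (f : Metric.ball (0 : E) r → E) : E →ᵇ E :=
  sigma A (cutExtend r ξ (remainder A f))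

/-- `f ↦ w_{g_f}`, where `g_f` is the cut-off nonlinearity of `f`. -/
noncomputable def tauTilde (A : E ≃L[𝕜] E) {r : ℝ} (ξ : E → 𝕜)
    (f : Metric.ball (0 : E) r → E) : E →ᵇ E :=
  tau A (cutExtend r ξ (remainder A f))

/-- The map `g ↦ A + g|_{B_r(0)}`. -/
def addLinear (A : E ≃L[𝕜] E) {P : Set E} {h0 : (0 : E) ∈ P} {r : ℝ}
    (hrP : Metric.ball (0 : E) r ⊆ P) (g : C1Zero 𝕜 P h0) : Metric.ball (0 : E) r → E :=
  fun x => A x + restrictBall hrP g x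

/-- The set of all `g` such that `A + g|_{B_r(0)}` belongs to `tildeOmega`. -/
def Omega (A : E ≃L[𝕜] E) (δ L : ℝ≥0) {P : Set E} (h0 : (0 : E) ∈ P) {r : ℝ} (hr : 0 < r)
    (hrP : Metric.ball (0 : E) r ⊆ P) : Set (C1Zero 𝕜 P h0) :=
  {g | addLinear A hrP g ∈ tildeOmega A δ L hr}

/-- The restriction of `u : E → E` to the open ball `B_t(0)`. -/
def onBall (t : ℝ) (u : E →ᵇ E) : Metric.ball (0 : E) t → E := fun x => u x

end Main

end GrobmanHartman

/-! The equation `(A + g) ∘ (id + v) = (id + v) ∘ (A + h)` is treated for two small perturbations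
`g`, `h` at once. Its stable component can be solved forward (`v` at `x` from `v` at `H⁻¹ x`, with
`H = A + h`) and its unstable component backward through `A⁻¹`. For the maximum norm the resulting
operator `conjOp` is a contraction of `BC(E, E)` with constant `max (a_s + δ) (a_u (1 + δ))`, which
gives existence and uniqueness, and Lipschitz dependence on `g` (`IsHypSplit.norm_conjOp_sub_le`).

The numerical hypotheses on `α`, `ε`, `δ` say precisely that `conjOp` preserves Hölder continuity
with exponent `α` and constant `ε r ^ (1 - α)` (`IsHypSplit.conjOp_holder`), so the fixed point
inherits it. Solving for the pairs `(g, 0)` and `(0, g)` and applying uniqueness to `(g, g)` and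
`(0, 0)` makes the two solutions inverse to each other; hence `w` has the same Hölder constant as
`v` (`IsAdapted.sigma_tau_spec`). Hölder dependence of `w` on `g` follows from that of `v` and the
uniform Hölder bound on `w`, and interpolation between the uniform and the `α`-Hölder bounds gives
continuity into `BL_β` for `β < α`.

The cut-off turns a nonlinearity on the ball into a global one with Lipschitz constant `δ`
(`lipschitzWith_cutExtend`). Finally, closeness to `0` in the compact-open `C¹`-topology controls
difference quotients on a compact set, hence Lipschitz constants on the ball
(`eventually_lipschitzOnWith`). -/

namespace GrobmanHartman

/-! ### Hyperbolic splittings and the maximum norm. -/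

section Splitting

variable {𝕜 E : Type*} [NontriviallyNormedField 𝕜] [NormedAddCommGroup E] [NormedSpace 𝕜 E]

/-- `p` and `q` are complementary projections commuting with `A`, for which the norm is a maximum
norm, such that `A` has norm at most `a` on the range of `p` and `A⁻¹` has norm at most `b` on the
range of `q`. -/
structure IsHypSplit (A : E ≃L[𝕜] E) (a b : ℝ) (p q : E →L[𝕜] E) : Prop where
  nonneg_left : 0 ≤ a
  nonneg_right : 0 ≤ b
  add_apply : ∀ x, p x + q x = x
  norm_eq : ∀ x, ‖x‖ = max ‖p x‖ ‖q x‖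
  left_left : ∀ x, p (p x) = p x
  left_right : ∀ x, p (q x) = 0
  right_left : ∀ x, q (p x) = 0
  right_right : ∀ x, q (q x) = q x
  left_map : ∀ x, p (A x) = A (p x)
  right_map : ∀ x, q (A x) = A (q x)
  norm_map_left : ∀ x, ‖A (p x)‖ ≤ a * ‖p x‖
  norm_symm_right : ∀ x, ‖A.symm (q x)‖ ≤ b * ‖q x‖

theorem IsAdapted.exists_isHypSplit [CompleteSpace 𝕜] [FiniteDimensional 𝕜 E]
    {A : E ≃L[𝕜] E} {Es Eu : Submodule 𝕜 E} (hA : IsAdapted A Es Eu) :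
    ∃ p q, IsHypSplit A (stableNorm A Es) (unstableNorm A Eu) p q := by
  let p : E →ₗ[𝕜] E := Es.projection Eu hA.isCompl
  let q : E →ₗ[𝕜] E := Eu.projection Es hA.isCompl.symm
  have hp : ∀ x, p x ∈ Es := Submodule.projection_apply_mem _
  have hq : ∀ x, q x ∈ Eu := Submodule.projection_apply_mem _
  have hpq : ∀ x, p x + q x = x := Submodule.projection_add_projection_eq_self hA.isCompl
  have hps : ∀ x ∈ Es, p x = x := fun x hx => Submodule.projection_apply_of_mem_left _ hx
  have hqu : ∀ x ∈ Eu, q x = x := fun x hx => Submodule.projection_apply_of_mem_left _ hx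
  have hpu : ∀ x ∈ Eu, p x = 0 := fun x hx => by
    have := hpq x
    rwa [hqu x hx, add_eq_right] at this
  have hqs : ∀ x ∈ Es, q x = 0 := fun x hx => by
    have := hpq x
    rwa [hps x hx, add_eq_left] at this
  refine ⟨LinearMap.toContinuousLinearMap p, LinearMap.toContinuousLinearMap q,
    norm_nonneg _, norm_nonneg _, hpq, fun x => ?_, fun x => hps _ (hp x), fun x => hpu _ (hq x),
    fun x => hqs _ (hp x), fun x => hqu _ (hq x), fun x => ?_, fun x => ?_, fun x => ?_,
    fun x => ?_⟩
  · conv_lhs => rw [← hpq x]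
    exact hA.norm_add _ (hp x) _ (hq x)
  · change p (A x) = A (p x)
    conv_lhs => rw [← hpq x, map_add, map_add, hps _ (hA.stable_invariant _ (hp x)),
      hpu _ (hA.unstable_invariant _ (hq x)), add_zero]
  · change q (A x) = A (q x)
    conv_lhs => rw [← hpq x, map_add, map_add, hqs _ (hA.stable_invariant _ (hp x)),
      hqu _ (hA.unstable_invariant _ (hq x)), zero_add]
  · exact ((A : E →L[𝕜] E).comp Es.subtypeL).le_opNorm ⟨p x, hp x⟩
  · exact ((A.symm : E →L[𝕜] E).comp Eu.subtypeL).le_opNorm ⟨q x, hq x⟩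

namespace IsHypSplit

variable {A : E ≃L[𝕜] E} {a b : ℝ} {p q : E →L[𝕜] E} (hpq : IsHypSplit A a b p q)
include hpq

theorem norm_left_le (x : E) : ‖p x‖ ≤ ‖x‖ := by
  rw [hpq.norm_eq x]; exact le_max_left _ _

theorem norm_right_le (x : E) : ‖q x‖ ≤ ‖x‖ := by
  rw [hpq.norm_eq x]; exact le_max_right _ _

theorem left_symm (x : E) : p (A.symm x) = A.symm (p x) := by
  rw [A.eq_symm_apply, ← hpq.left_map, A.apply_symm_apply]

theorem right_symm (x : E) : q (A.symm x) = A.symm (q x) := by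
  rw [A.eq_symm_apply, ← hpq.right_map, A.apply_symm_apply]

/-- The first two summands lie in the range of `p` and the third in that of `q`, so stable and
unstable contributions enter a maximum and are never added. This is the shape of a value of
`conjOp`. -/
theorem norm_combine_le (x y z : E) :
    ‖A (p x) + p y + A.symm (q z)‖ ≤ max (a * ‖x‖ + ‖y‖) (b * ‖z‖) := by
  rw [hpq.norm_eq]
  simp only [map_add, hpq.left_map, hpq.right_map, hpq.left_symm, hpq.right_symm, hpq.left_left,
    hpq.left_right, hpq.right_left, hpq.right_right, map_zero, add_zero, zero_add]
  refine max_le_max ?_ ?_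
  · refine (norm_add_le _ _).trans (add_le_add ?_ (hpq.norm_left_le y))
    exact (hpq.norm_map_left x).trans
      (mul_le_mul_of_nonneg_left (hpq.norm_left_le x) hpq.nonneg_left)
  · exact (hpq.norm_symm_right z).trans
      (mul_le_mul_of_nonneg_left (hpq.norm_right_le z) hpq.nonneg_right)

end IsHypSplit

end Splitting

/-! ### Lipschitz perturbations of a linear automorphism. -/

section Perturb

variable {𝕜 E : Type*} [NontriviallyNormedField 𝕜] [NormedAddCommGroup E] [NormedSpace 𝕜 E]

/-- The homeomorphism `A + h` for `h` with small Lipschitz constant. -/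
noncomputable def perturb [CompleteSpace E] (A : E ≃L[𝕜] E) {h : E → E} {δ : ℝ≥0}
    (hh : LipschitzWith δ h) (hδ : (δ : ℝ) < ‖(A.symm : E →L[𝕜] E)‖⁻¹) : E ≃ₜ E :=
  ApproximatesLinearOn.toHomeomorph (f' := A) (c := δ) (fun x => A x + h x)
    (fun x _ y _ => by
      have := hh.norm_sub_le x y
      simpa [add_sub_add_comm] using this)
    (Or.inr (by rw [← NNReal.coe_lt_coe]; exact hδ))

@[simp]
theorem perturb_apply [CompleteSpace E] (A : E ≃L[𝕜] E) {h : E → E} {δ : ℝ≥0}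
    (hh : LipschitzWith δ h) (hδ : (δ : ℝ) < ‖(A.symm : E →L[𝕜] E)‖⁻¹) (x : E) :
    perturb A hh hδ x = A x + h x := rfl

theorem norm_perturb_sub_le [CompleteSpace E] (A : E ≃L[𝕜] E) {h : E → E} {δ : ℝ≥0}
    (hh : LipschitzWith δ h) (hδ : (δ : ℝ) < ‖(A.symm : E →L[𝕜] E)‖⁻¹) (x y : E) :
    ‖perturb A hh hδ x - perturb A hh hδ y‖ ≤ (‖(A : E →L[𝕜] E)‖ + δ) * ‖x - y‖ := by
  rw [perturb_apply, perturb_apply, add_sub_add_comm, ← map_sub, add_mul]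
  exact (norm_add_le _ _).trans
    (add_le_add ((A : E →L[𝕜] E).le_opNorm _) (hh.norm_sub_le x y))

/-- `A` expands distances at least by the factor `‖A⁻¹‖⁻¹`, and `h` takes away at most `δ`. -/
theorem norm_perturb_symm_sub_le [CompleteSpace E] (A : E ≃L[𝕜] E) {h : E → E} {δ : ℝ≥0}
    (hh : LipschitzWith δ h) (hδ : (δ : ℝ) < ‖(A.symm : E →L[𝕜] E)‖⁻¹) (x y : E) :
    ‖(perturb A hh hδ).symm x - (perturb A hh hδ).symm y‖
      ≤ ‖x - y‖ / (‖(A.symm : E →L[𝕜] E)‖⁻¹ - δ) := by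
  set H := perturb A hh hδ with hH
  obtain ⟨x, rfl⟩ := H.surjective x
  obtain ⟨y, rfl⟩ := H.surjective y
  rw [H.symm_apply_apply, H.symm_apply_apply, le_div_iff₀ (sub_pos.2 hδ)]
  have hpos : 0 < ‖(A.symm : E →L[𝕜] E)‖ := inv_pos.1 (δ.2.trans_lt hδ)
  have h1 : ‖(A.symm : E →L[𝕜] E)‖⁻¹ * ‖x - y‖ ≤ ‖A (x - y)‖ := by
    rw [inv_mul_le_iff₀ hpos]
    simpa using (A.symm : E →L[𝕜] E).le_opNorm (A (x - y))
  have h2 := hh.norm_sub_le x y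
  have h3 : H x - H y = A (x - y) + (h x - h y) := by
    rw [hH, perturb_apply, perturb_apply, add_sub_add_comm, map_sub]
  have h4 := norm_sub_norm_le (A (x - y)) (-(h x - h y))
  rw [norm_neg, sub_neg_eq_add, ← h3] at h4
  linarith

end Perturb

/-! ### Hölder moduli at a fixed scale. -/

section HolderConst

/-- The smallness conditions under which Hölder bounds are preserved by `conjOp`. Here `N` and `m`
play the roles of `‖A‖` and `‖A⁻¹‖⁻¹`. -/
structure HolderConst (a b N m : ℝ) (α ε δ : ℝ≥0) : Prop where
  lt : δ < m
  unstable_le : 2 * b * δ + ε * b * (N + δ) ^ (α : ℝ) + b * max ((δ : ℝ) * (1 + ε)) (2 * δ) ≤ ε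
  stable_le : ε * a / (m - δ) ^ (α : ℝ) + max ((δ : ℝ) / (m - δ)) (2 * δ)
    + max ((δ : ℝ) * (1 + ε)) (2 * δ) / (m - δ) ^ (α : ℝ) ≤ ε

/-- With the factor `ρ ^ (1 - α)` the Hölder modulus equals `ρ` at distance `ρ`. Below this scale it
dominates the distance, so Lipschitz bounds suffice; above it, it dominates `ρ`, so sup bounds
suffice. -/
theorem le_scaled_rpow {ρ d : ℝ} {α : ℝ≥0} (hρ : 0 < ρ) (hα1 : α ≤ 1) (hd : 0 ≤ d)
    (hdρ : d ≤ ρ) : d ≤ ρ ^ (1 - α : ℝ) * d ^ (α : ℝ) := by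
  rcases hd.eq_or_lt with rfl | hd'
  · positivity
  calc d = d ^ (1 - α : ℝ) * d ^ (α : ℝ) := by
        rw [← Real.rpow_add hd', sub_add_cancel, Real.rpow_one]
    _ ≤ _ := by
        have : (0 : ℝ) ≤ 1 - α := sub_nonneg.2 (by exact_mod_cast hα1)
        gcongr

theorem self_le_scaled_rpow {ρ d : ℝ} {α : ℝ≥0} (hρ : 0 < ρ)
    (hdρ : ρ ≤ d) : ρ ≤ ρ ^ (1 - α : ℝ) * d ^ (α : ℝ) := by
  calc ρ = ρ ^ (1 - α : ℝ) * ρ ^ (α : ℝ) := by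
        rw [← Real.rpow_add hρ, sub_add_cancel, Real.rpow_one]
    _ ≤ _ := by gcongr

end HolderConst

/-! ### The conjugacy equation as a fixed point problem. -/

section ConjOp

variable {𝕜 E : Type*} [NontriviallyNormedField 𝕜] [NormedAddCommGroup E] [NormedSpace 𝕜 E]

/-- `(A + g) ∘ (id + v) = (id + v) ∘ (A + h)`. -/
def IsConjPair (A : E ≃L[𝕜] E) (g h : E → E) (v : E →ᵇ E) : Prop :=
  ∀ x, A (x + v x) + g (x + v x) = A x + h x + v (A x + h x)

/-- The operator whose fixed points `v` satisfy `(A + g) ∘ (id + v) = (id + v) ∘ (A + h)`, where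
`H = A + h`. -/
noncomputable def conjOp (A : E ≃L[𝕜] E) (p q : E →L[𝕜] E) (g h : E →ᵇ E) (H : E ≃ₜ E)
    (v : E →ᵇ E) : E →ᵇ E :=
  BoundedContinuousFunction.ofNormedAddCommGroup
    (fun x => A (p (v (H.symm x))) + p (g (H.symm x + v (H.symm x)) - h (H.symm x))
      + A.symm (q (v (H x) + h x - g (x + v x))))
    (by fun_prop)
    (‖(A : E →L[𝕜] E).comp p‖ * ‖v‖ + ‖p‖ * (‖g‖ + ‖h‖)
      + ‖(A.symm : E →L[𝕜] E).comp q‖ * (‖v‖ + ‖h‖ + ‖g‖))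
    (fun x => by
      refine norm_add_le_of_le (norm_add_le_of_le ?_ ?_) ?_
      · exact ((A : E →L[𝕜] E).comp p).le_opNorm_of_le (v.norm_coe_le_norm _)
      · exact p.le_opNorm_of_le
          (norm_sub_le_of_le (g.norm_coe_le_norm _) (h.norm_coe_le_norm _))
      · exact ((A.symm : E →L[𝕜] E).comp q).le_opNorm_of_le
          (norm_sub_le_of_le (norm_add_le_of_le (v.norm_coe_le_norm _) (h.norm_coe_le_norm _))
            (g.norm_coe_le_norm _)))

theorem conjOp_apply (A : E ≃L[𝕜] E) (p q : E →L[𝕜] E) (g h : E →ᵇ E) (H : E ≃ₜ E)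
    (v : E →ᵇ E) (x : E) : conjOp A p q g h H v x =
      A (p (v (H.symm x))) + p (g (H.symm x + v (H.symm x)) - h (H.symm x))
        + A.symm (q (v (H x) + h x - g (x + v x))) := rfl

variable {A : E ≃L[𝕜] E} {a b : ℝ} {p q : E →L[𝕜] E} (hpq : IsHypSplit A a b p q)
include hpq

/-- Conjugacy means `v ∘ H = A ∘ v + g ∘ (id + v) - h`. Its `p`-part is read at `H⁻¹ x`, and its
`q`-part is solved for `q (v x)` by `A⁻¹`, so that only contracting linear maps act on `v`. -/
theorem IsHypSplit.conjOp_eq_iff {g h v : E →ᵇ E} {H : E ≃ₜ E} (hH : ∀ x, H x = A x + h x) :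
    conjOp A p q g h H v = v ↔ IsConjPair A g h v := by
  constructor
  · intro hv x
    have key : ∀ y, v y = A (p (v (H.symm y))) + p (g (H.symm y + v (H.symm y)) - h (H.symm y))
        + A.symm (q (v (H y) + h y - g (y + v y))) := fun y => by
      rw [← conjOp_apply, hv]
    have h1 : p (v (H x)) = A (p (v x)) + p (g (x + v x) - h x) := by
      conv_lhs => rw [key (H x)]
      simp only [H.symm_apply_apply, map_add, hpq.left_map, hpq.left_symm,
        hpq.left_left, hpq.left_right, map_zero, add_zero]
    have h2 : A (q (v x)) = q (v (H x) + h x - g (x + v x)) := by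
      conv_lhs => rw [key x]
      simp only [map_add, hpq.right_map, hpq.right_symm, hpq.right_left, hpq.right_right, map_zero,
        zero_add, A.apply_symm_apply]
    have h3 : v (H x) = A (v x) + (g (x + v x) - h x) := by
      have h4 : q (v (H x)) = A (q (v x)) + q (g (x + v x) - h x) := by
        rw [h2, map_sub, map_add, map_sub]; abel
      rw [← hpq.add_apply (v (H x)), h1, h4, add_add_add_comm, ← map_add, hpq.add_apply,
        hpq.add_apply]
    rw [← hH, h3, hH, map_add]
    abel
  · intro hv
    have h3 : ∀ x, v (H x) = A (v x) + g (x + v x) - h x := fun x => by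
      have := hv x
      rw [← hH, hH, map_add] at this
      rw [hH, eq_sub_iff_add_eq, ← add_right_inj (A x), ← add_assoc (A x) (A (v x)), this]
      abel
    ext y
    rw [conjOp_apply]
    have h4 : v (H y) + h y - g (y + v y) = A (v y) := by rw [h3]; abel
    have h5 := h3 (H.symm y)
    rw [H.apply_symm_apply] at h5
    rw [h4, hpq.right_map, A.symm_apply_apply, ← hpq.left_map, ← map_add, add_sub, ← h5,
      hpq.add_apply]

/-- Letting `v` and `g` vary together yields both the contraction property (`D = 0`) and the
dependence of fixed points on `g`. -/
theorem IsHypSplit.norm_conjOp_sub_le {g g' h : E →ᵇ E} {δ : ℝ≥0} (hg : LipschitzWith δ g)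
    {H : E ≃ₜ E} {D : ℝ} (hD : ∀ x, ‖g x - g' x‖ ≤ D) (v v' : E →ᵇ E) :
    dist (conjOp A p q g h H v) (conjOp A p q g' h H v')
      ≤ max (a + δ) (b * (1 + δ)) * dist v v' + max 1 b * D := by
  have ha := hpq.nonneg_left
  have hb := hpq.nonneg_right
  have hD0 : 0 ≤ D := (norm_nonneg _).trans (hD 0)
  rw [dist_eq_norm v v']
  -- Passing through `g (x + v' x)` uses the Lipschitz bound of `g` only; `g'` just has to be near
  -- `g`.
  have hg' : ∀ x, ‖g (x + v x) - g' (x + v' x)‖ ≤ δ * ‖v - v'‖ + D := fun x => by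
    rw [← sub_add_sub_cancel _ (g (x + v' x))]
    refine norm_add_le_of_le ((hg.norm_sub_le _ _).trans ?_) (hD _)
    rw [add_sub_add_left_eq_sub]
    exact mul_le_mul_of_nonneg_left ((v - v').norm_coe_le_norm x) δ.2
  refine (BoundedContinuousFunction.dist_le (by positivity)).2 fun x => ?_
  rw [dist_eq_norm, conjOp_apply, conjOp_apply]
  have e : ∀ y : E, ‖v y - v' y‖ ≤ ‖v - v'‖ := fun y => (v - v').norm_coe_le_norm y
  set y := H.symm x
  have : A (p (v y)) + p (g (y + v y) - h y) + A.symm (q (v (H x) + h x - g (x + v x)))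
      - (A (p (v' y)) + p (g' (y + v' y) - h y) + A.symm (q (v' (H x) + h x - g' (x + v' x))))
      = A (p (v y - v' y)) + p (g (y + v y) - g' (y + v' y))
        + A.symm (q ((v (H x) - v' (H x)) - (g (x + v x) - g' (x + v' x)))) := by
    simp only [map_add, map_sub]; abel
  rw [this]
  refine (hpq.norm_combine_le _ _ _).trans (max_le ?_ ?_)
  · calc _ ≤ a * ‖v - v'‖ + (δ * ‖v - v'‖ + D) :=
          add_le_add (mul_le_mul_of_nonneg_left (e y) ha) (hg' y)
      _ = (a + δ) * ‖v - v'‖ + 1 * D := by ring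
      _ ≤ _ := by gcongr <;> exact le_max_left _ _
  · calc _ ≤ b * (‖v - v'‖ + (δ * ‖v - v'‖ + D)) :=
          mul_le_mul_of_nonneg_left (norm_sub_le_of_le (e _) (hg' x)) hb
      _ = (b * (1 + δ)) * ‖v - v'‖ + b * D := by ring
      _ ≤ _ := by gcongr <;> exact le_max_right _ _

theorem IsHypSplit.contractingWith_conjOp {g h : E →ᵇ E} {δ : ℝ≥0} (hg : LipschitzWith δ g)
    {H : E ≃ₜ E} (hs : a + δ < 1) (hu : b * (1 + δ) < 1) :
    ContractingWith (max (a + δ) (b * (1 + δ))).toNNReal (conjOp A p q g h H) := by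
  refine ⟨?_, LipschitzWith.of_dist_le_mul fun v v' => ?_⟩
  · rw [Real.toNNReal_lt_one]
    exact max_lt hs hu
  · have := hpq.norm_conjOp_sub_le (h := h) hg (H := H) (D := 0) (g' := g) (by simp) v v'
    rw [mul_zero, add_zero] at this
    have h0 : 0 ≤ max (a + (δ : ℝ)) (b * (1 + δ)) :=
      le_max_of_le_left (add_nonneg hpq.nonneg_left δ.2)
    rwa [Real.coe_toNNReal _ h0]

/-- If `g` is perturbed, the solutions of the conjugacy equations vary in a Lipschitz way. -/
theorem IsHypSplit.dist_le_of_isConjPair {g g' h v v' : E →ᵇ E} {δ : ℝ≥0}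
    (hg : LipschitzWith δ g) {H : E ≃ₜ E} (hH : ∀ x, H x = A x + h x)
    (hs : a + δ < 1) (hu : b * (1 + δ) < 1) {D : ℝ} (hD : ∀ x, ‖g x - g' x‖ ≤ D)
    (hv : IsConjPair A g h v) (hv' : IsConjPair A g' h v') :
    dist v v' ≤ max 1 b / (1 - max (a + δ) (b * (1 + δ))) * D := by
  have := hpq.norm_conjOp_sub_le (h := h) hg (H := H) hD v v'
  rw [(hpq.conjOp_eq_iff hH).2 hv, (hpq.conjOp_eq_iff hH).2 hv'] at this
  have h1 := max_lt hs hu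
  rw [div_mul_eq_mul_div, le_div_iff₀ (sub_pos.2 h1)]
  linarith

/-- Each term is compared with the modulus `ρ ^ (1 - α) * d ^ α`, by a Lipschitz estimate for `d ≤
ρ` and a sup estimate for `d ≥ ρ`; this produces the maxima in `HolderConst`. The stable and
unstable totals are then the two inequalities assumed there. -/
theorem IsHypSplit.conjOp_holder {g h : E →ᵇ E} {δ ε α : ℝ≥0} (hg : LipschitzWith δ g)
    (hh : LipschitzWith δ h) {H : E ≃ₜ E} {N m ρ : ℝ} (hN : 0 ≤ N)
    (hHL : ∀ x y, ‖H x - H y‖ ≤ (N + δ) * ‖x - y‖)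
    (hHsL : ∀ x y, ‖H.symm x - H.symm y‖ ≤ ‖x - y‖ / (m - δ))
    (hc : HolderConst a b N m α ε δ) (hα1 : α ≤ 1) (hρ : 0 < ρ)
    (hgρ : ∀ x, ‖g x‖ ≤ δ * ρ) (hhρ : ∀ x, ‖h x‖ ≤ δ * ρ) {v : E →ᵇ E}
    (hv : ∀ x y, ‖v x - v y‖ ≤ ε * (ρ ^ (1 - α : ℝ) * ‖x - y‖ ^ (α : ℝ))) (x y : E) :
    ‖conjOp A p q g h H v x - conjOp A p q g h H v y‖
      ≤ ε * (ρ ^ (1 - α : ℝ) * ‖x - y‖ ^ (α : ℝ)) := by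
  have ha := hpq.nonneg_left
  have hb := hpq.nonneg_right
  have hm : 0 < m - δ := sub_pos.2 hc.lt
  set M : ℝ := ρ ^ (1 - α : ℝ) with hM
  have hM0 : 0 ≤ M := by positivity
  have hδ := δ.2
  have hε := ε.2
  have hG : ∀ x y, ‖g (x + v x) - g (y + v y)‖
      ≤ max ((δ : ℝ) * (1 + ε)) (2 * δ) * (M * ‖x - y‖ ^ (α : ℝ)) := fun x y => by
    have hω : 0 ≤ M * ‖x - y‖ ^ (α : ℝ) := by positivity
    rcases le_total ‖x - y‖ ρ with hd | hd
    · have h1 := le_scaled_rpow hρ hα1 (norm_nonneg (x - y)) hd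
      calc _ ≤ δ * ‖(x + v x) - (y + v y)‖ := hg.norm_sub_le _ _
        _ ≤ δ * (M * ‖x - y‖ ^ (α : ℝ) + ε * (M * ‖x - y‖ ^ (α : ℝ))) := by
          rw [add_sub_add_comm]
          exact mul_le_mul_of_nonneg_left (norm_add_le_of_le h1 (hv x y)) hδ
        _ = (δ * (1 + ε)) * (M * ‖x - y‖ ^ (α : ℝ)) := by ring
        _ ≤ _ := mul_le_mul_of_nonneg_right (le_max_left _ _) hω
    · have h1 := self_le_scaled_rpow (α := α) hρ hd
      calc _ ≤ δ * ρ + δ * ρ := norm_sub_le_of_le (hgρ _) (hgρ _)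
        _ = 2 * δ * ρ := by ring
        _ ≤ 2 * δ * (M * ‖x - y‖ ^ (α : ℝ)) := by gcongr
        _ ≤ _ := mul_le_mul_of_nonneg_right (le_max_right _ _) hω
  have hh1 : ∀ x y, ‖h x - h y‖ ≤ 2 * δ * (M * ‖x - y‖ ^ (α : ℝ)) := fun x y => by
    rcases le_total ‖x - y‖ ρ with hd | hd
    · have h1 := le_scaled_rpow hρ hα1 (norm_nonneg (x - y)) hd
      have h2 := hh.norm_sub_le x y
      have : δ * ‖x - y‖ ≤ δ * (M * ‖x - y‖ ^ (α : ℝ)) := by gcongr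
      have : 0 ≤ δ * (M * ‖x - y‖ ^ (α : ℝ)) := by positivity
      linarith
    · have h1 := self_le_scaled_rpow (α := α) hρ hd
      calc _ ≤ δ * ρ + δ * ρ := norm_sub_le_of_le (hhρ _) (hhρ _)
        _ = 2 * δ * ρ := by ring
        _ ≤ 2 * δ * (M * ‖x - y‖ ^ (α : ℝ)) := by gcongr
  have hh2 : ∀ x y, ‖h (H.symm x) - h (H.symm y)‖
      ≤ max ((δ : ℝ) / (m - δ)) (2 * δ) * (M * ‖x - y‖ ^ (α : ℝ)) := fun x y => by
    have hω : 0 ≤ M * ‖x - y‖ ^ (α : ℝ) := by positivity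
    rcases le_total ‖x - y‖ ρ with hd | hd
    · have h1 := le_scaled_rpow hρ hα1 (norm_nonneg (x - y)) hd
      calc _ ≤ δ * ‖H.symm x - H.symm y‖ := hh.norm_sub_le _ _
        _ ≤ δ * (‖x - y‖ / (m - δ)) := by gcongr; exact hHsL x y
        _ = δ / (m - δ) * ‖x - y‖ := by ring
        _ ≤ δ / (m - δ) * (M * ‖x - y‖ ^ (α : ℝ)) := by gcongr
        _ ≤ _ := mul_le_mul_of_nonneg_right (le_max_left _ _) hω
    · have h1 := self_le_scaled_rpow (α := α) hρ hd
      calc _ ≤ δ * ρ + δ * ρ := norm_sub_le_of_le (hhρ _) (hhρ _)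
        _ = 2 * δ * ρ := by ring
        _ ≤ 2 * δ * (M * ‖x - y‖ ^ (α : ℝ)) := by gcongr
        _ ≤ _ := mul_le_mul_of_nonneg_right (le_max_right _ _) hω
  -- Composition with `H⁻¹` or `H` multiplies the modulus by the `α`-th power of the respective
  -- Lipschitz constant.
  have hω : 0 ≤ M * ‖x - y‖ ^ (α : ℝ) := by positivity
  have hωs : M * ‖H.symm x - H.symm y‖ ^ (α : ℝ)
      ≤ M * ‖x - y‖ ^ (α : ℝ) / (m - δ) ^ (α : ℝ) := by
    rw [mul_div_assoc, ← Real.div_rpow (norm_nonneg _) hm.le]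
    gcongr
    exact hHsL x y
  have hωu : M * ‖H x - H y‖ ^ (α : ℝ)
      ≤ (N + δ) ^ (α : ℝ) * (M * ‖x - y‖ ^ (α : ℝ)) := by
    rw [mul_left_comm, ← Real.mul_rpow (by positivity) (norm_nonneg _)]
    gcongr
    exact hHL x y
  rw [conjOp_apply, conjOp_apply]
  have : A (p (v (H.symm x))) + p (g (H.symm x + v (H.symm x)) - h (H.symm x))
      + A.symm (q (v (H x) + h x - g (x + v x)))
      - (A (p (v (H.symm y))) + p (g (H.symm y + v (H.symm y)) - h (H.symm y))
        + A.symm (q (v (H y) + h y - g (y + v y))))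
      = A (p (v (H.symm x) - v (H.symm y)))
        + p ((g (H.symm x + v (H.symm x)) - g (H.symm y + v (H.symm y)))
          - (h (H.symm x) - h (H.symm y)))
        + A.symm (q ((v (H x) - v (H y)) + (h x - h y) - (g (x + v x) - g (y + v y)))) := by
    simp only [map_add, map_sub]; abel
  rw [this]
  refine (hpq.norm_combine_le _ _ _).trans (max_le ?_ ?_)
  · set W := M * ‖x - y‖ ^ (α : ℝ) with hW
    set mx := max ((δ : ℝ) * (1 + ε)) (2 * δ)
    have hmx : 0 ≤ mx := le_max_of_le_right (by positivity)
    calc _ ≤ a * (ε * (W / (m - δ) ^ (α : ℝ)))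
          + (mx * (W / (m - δ) ^ (α : ℝ)) + max ((δ : ℝ) / (m - δ)) (2 * δ) * W) := by
          gcongr
          · exact (hv _ _).trans (by gcongr)
          · exact norm_sub_le_of_le ((hG _ _).trans (by gcongr)) (hh2 x y)
      _ = (ε * a / (m - δ) ^ (α : ℝ) + max ((δ : ℝ) / (m - δ)) (2 * δ)
            + mx / (m - δ) ^ (α : ℝ)) * W := by ring
      _ ≤ _ := by gcongr; exact hc.stable_le
  · set W := M * ‖x - y‖ ^ (α : ℝ) with hW
    set mx := max ((δ : ℝ) * (1 + ε)) (2 * δ)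
    calc _ ≤ b * (ε * ((N + δ) ^ (α : ℝ) * W) + 2 * δ * W + mx * W) := by
          gcongr
          exact norm_sub_le_of_le (norm_add_le_of_le ((hv _ _).trans (by gcongr)) (hh1 x y))
            (hG x y)
      _ = (2 * b * δ + ε * b * (N + δ) ^ (α : ℝ) + b * mx) * W := by ring
      _ ≤ _ := by gcongr; exact hc.unstable_le

theorem IsHypSplit.exists_isConjPair [CompleteSpace E] {g h : E →ᵇ E} {δ ε α : ℝ≥0}
    (hg : LipschitzWith δ g) (hh : LipschitzWith δ h) {H : E ≃ₜ E} (hH : ∀ x, H x = A x + h x)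
    {N m ρ : ℝ} (hN : 0 ≤ N) (hHL : ∀ x y, ‖H x - H y‖ ≤ (N + δ) * ‖x - y‖)
    (hHsL : ∀ x y, ‖H.symm x - H.symm y‖ ≤ ‖x - y‖ / (m - δ))
    (hs : a + δ < 1) (hu : b * (1 + δ) < 1)
    (hc : HolderConst a b N m α ε δ) (hα1 : α ≤ 1) (hρ : 0 < ρ)
    (hgρ : ∀ x, ‖g x‖ ≤ δ * ρ) (hhρ : ∀ x, ‖h x‖ ≤ δ * ρ) :
    ∃ v : E →ᵇ E, IsConjPair A g h v ∧
      ∀ x y, ‖v x - v y‖ ≤ ε * (ρ ^ (1 - α : ℝ) * ‖x - y‖ ^ (α : ℝ)) := by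
  have hT := hpq.contractingWith_conjOp (h := h) hg (H := H) hs hu
  -- The iteration starts at `0`, which satisfies every Hölder bound, and such bounds survive
  -- pointwise limits.
  have hit : ∀ n x y, ‖(conjOp A p q g h H)^[n] 0 x - (conjOp A p q g h H)^[n] 0 y‖
      ≤ ε * (ρ ^ (1 - α : ℝ) * ‖x - y‖ ^ (α : ℝ)) := fun n => by
    induction n with
    | zero =>
      intro x y
      simp only [Function.iterate_zero, id_eq, BoundedContinuousFunction.coe_zero, Pi.zero_apply,
        sub_self, norm_zero]
      positivity
    | succ n ih =>
      rw [Function.iterate_succ_apply']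
      exact hpq.conjOp_holder hg hh hN hHL hHsL hc hα1 hρ hgρ hhρ ih
  refine ⟨ContractingWith.fixedPoint _ hT, (hpq.conjOp_eq_iff hH).1 hT.fixedPoint_isFixedPt,
    fun x y => ?_⟩
  have ht := hT.tendsto_iterate_fixedPoint 0
  have hev : ∀ x : E, Continuous fun v : E →ᵇ E => v x := fun x =>
    continuous_eval_const x
  exact le_of_tendsto ((((hev x).tendsto _).comp ht).sub (((hev y).tendsto _).comp ht)).norm
    (Filter.Eventually.of_forall fun n => hit n x y)

end ConjOp

/-! ### Inverse conjugacies and dependence on the nonlinearity. -/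

section Conjugacies

variable {𝕜 E : Type*} [NontriviallyNormedField 𝕜] [NormedAddCommGroup E] [NormedSpace 𝕜 E]
  {A : E ≃L[𝕜] E}

/-- The bounded part of `(id + v) ∘ (id + w)`. -/
noncomputable def compCorrection (v w : E →ᵇ E) : E →ᵇ E :=
  w + v.compContinuous ⟨fun x => x + w x, by fun_prop⟩

@[simp]
theorem compCorrection_apply (v w : E →ᵇ E) (x : E) :
    compCorrection v w x = w x + v (x + w x) := rfl

/-- Conjugacies compose; together with uniqueness this identifies inverses. -/
theorem IsConjPair.comp {g h k v w : E →ᵇ E} (hv : IsConjPair A g h v)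
    (hw : IsConjPair A h k w) : IsConjPair A g k (compCorrection v w) := fun x => by
  have h1 := hv (x + w x)
  rw [hw x] at h1
  simp only [compCorrection_apply]
  rw [← add_assoc, h1, add_assoc]

theorem isConjPair_self (g : E →ᵇ E) : IsConjPair A g g 0 := fun x => by simp

theorem isConjPair_zero_iff {g : E → E} {v : E →ᵇ E} :
    IsConjPair A g (0 : E →ᵇ E) v ↔ IsConj A g v := by
  simp [IsConj, IsConjPair]

theorem IsInv.eq {v w w' : E →ᵇ E} (h : IsInv v w) (h' : IsInv v w') : w' = w := by
  ext x
  have := h'.2 (x + w x)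
  rw [h.1 x] at this
  exact add_left_cancel this

theorem tau_eq {g : E → E} {w : E →ᵇ E} (hw : IsInv (sigma A g) w) : tau A g = w := by
  have h : ∃ w : E →ᵇ E, IsInv (sigma A g) w := ⟨w, hw⟩
  rw [tau, dif_pos h]
  exact hw.eq h.choose_spec

theorem sigma_eq {g : E → E} {v : E →ᵇ E} (hv : IsConj A g v)
    (huniq : ∀ u, IsConj A g u → u = v) : sigma A g = v := by
  have h : ∃! v : E →ᵇ E, IsConj A g v := ⟨v, hv, huniq⟩
  rw [sigma, dif_pos h]
  exact huniq _ h.exists.choose_spec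

/-- At `y = x + w' x` the points `x = y + v' y` and `y + v y` differ by `v' y - v y`. Hence `w x -
w' x` is this difference plus an increment of `w` over it, and only `w` has to be Hölder. -/
theorem IsInv.dist_le {v v' w w' : E →ᵇ E} (h : IsInv v w) (h' : IsInv v' w') {C : ℝ} (hC : 0 ≤ C)
    {α : ℝ≥0} (hw : ∀ x y, ‖w x - w y‖ ≤ C * ‖x - y‖ ^ (α : ℝ)) :
    dist w w' ≤ dist v v' + C * dist v v' ^ (α : ℝ) := by
  refine (BoundedContinuousFunction.dist_le (by positivity)).2 fun x => ?_
  set y := x + w' x with hy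
  have h1 : y + v' y = x := h'.1 x
  have h2 := h.2 y
  have h3 : ‖v' y - v y‖ ≤ dist v v' := by
    rw [← dist_eq_norm, dist_comm]
    exact BoundedContinuousFunction.dist_coe_le_dist y
  have h4 : x - (y + v y) = v' y - v y := by
    conv_lhs => rw [← h1]
    abel
  have h5 : w x - w' x = (v' y - v y) + (w x - w (y + v y)) := by
    have : w' x = y - x := by rw [hy]; abel
    rw [this, ← h4]
    conv_lhs => rw [← h2]
    abel
  rw [dist_eq_norm, h5]
  refine norm_add_le_of_le h3 ((hw _ _).trans ?_)
  rw [h4]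
  gcongr

/-- `g` is Lipschitz with constant `δ` and bounded by `δ * ρ`. -/
def IsSmallPert (δ : ℝ≥0) (ρ : ℝ) (g : E →ᵇ E) : Prop :=
  LipschitzWith δ g ∧ ∀ x, ‖g x‖ ≤ δ * ρ

theorem isSmallPert_zero {δ : ℝ≥0} {ρ : ℝ} (hρ : 0 < ρ) : IsSmallPert δ ρ (0 : E →ᵇ E) :=
  ⟨LipschitzWith.of_dist_le_mul fun x y => by simp; positivity, fun x => by simp; positivity⟩

variable [CompleteSpace 𝕜] [FiniteDimensional 𝕜 E] {Es Eu : Submodule 𝕜 E} {α ε δ : ℝ≥0}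
  {ρ : ℝ}

theorem IsAdapted.exists_isConjPair (hA : IsAdapted A Es Eu) (hc : Admissible A Es Eu α ε δ)
    (hρ : 0 < ρ) {g h : E →ᵇ E} (hg : IsSmallPert δ ρ g) (hh : IsSmallPert δ ρ h) :
    ∃ v : E →ᵇ E, IsConjPair A g h v ∧
      ∀ x y, ‖v x - v y‖ ≤ ε * ρ ^ (1 - α : ℝ) * ‖x - y‖ ^ (α : ℝ) := by
  have := FiniteDimensional.complete 𝕜 E
  obtain ⟨p, q, hpq⟩ := hA.exists_isHypSplit
  simp only [mul_assoc]
  exact hpq.exists_isConjPair hg.1 hh.1 (perturb_apply A hh.1 hc.delta_lt) (norm_nonneg _)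
    (norm_perturb_sub_le A hh.1 hc.delta_lt) (norm_perturb_symm_sub_le A hh.1 hc.delta_lt)
    hc.stable_lt hc.unstable_lt ⟨hc.delta_lt, hc.unstable_le, hc.stable_le⟩ hc.exp_lt_one.le hρ
    hg.2 hh.2

theorem IsAdapted.exists_dist_le (hA : IsAdapted A Es Eu) (hc : Admissible A Es Eu α ε δ) :
    ∃ K : ℝ≥0, ∀ {g g' h v v' : E →ᵇ E}, LipschitzWith δ g → LipschitzWith δ h →
      IsConjPair A g h v → IsConjPair A g' h v' → ∀ {D : ℝ}, (∀ x, ‖g x - g' x‖ ≤ D) →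
      dist v v' ≤ K * D := by
  have := FiniteDimensional.complete 𝕜 E
  obtain ⟨p, q, hpq⟩ := hA.exists_isHypSplit
  refine ⟨⟨max 1 (unstableNorm A Eu)
    / (1 - max (stableNorm A Es + δ) (unstableNorm A Eu * (1 + δ))),
    div_nonneg (le_max_of_le_left zero_le_one)
      (sub_nonneg.2 (max_le hc.stable_lt.le hc.unstable_lt.le))⟩,
    fun hg hh hv hv' D hD => ?_⟩
  exact hpq.dist_le_of_isConjPair hg (perturb_apply A hh hc.delta_lt) hc.stable_lt hc.unstable_lt
    hD hv hv'

theorem IsAdapted.isConjPair_unique (hA : IsAdapted A Es Eu) (hc : Admissible A Es Eu α ε δ)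
    {g h v v' : E →ᵇ E} (hg : LipschitzWith δ g) (hh : LipschitzWith δ h)
    (hv : IsConjPair A g h v) (hv' : IsConjPair A g h v') : v = v' := by
  obtain ⟨K, hK⟩ := hA.exists_dist_le hc
  have := hK hg hh hv hv' (D := 0) (by simp)
  rw [mul_zero] at this
  exact dist_le_zero.1 this

/-- `v` solves the pair `(g, 0)` and `w` the pair `(0, g)`. Both composites conjugate a map to
itself, so uniqueness makes their bounded parts vanish. -/
theorem IsAdapted.sigma_tau_spec (hA : IsAdapted A Es Eu) (hc : Admissible A Es Eu α ε δ)
    (hρ : 0 < ρ) {g : E →ᵇ E} (hg : IsSmallPert δ ρ g) :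
    (∀ u, IsConj A g u ↔ u = sigma A g) ∧ IsInv (sigma A g) (tau A g) ∧
    (∀ x y, ‖sigma A g x - sigma A g y‖ ≤ ε * ρ ^ (1 - α : ℝ) * ‖x - y‖ ^ (α : ℝ)) ∧
    ∀ x y, ‖tau A g x - tau A g y‖ ≤ ε * ρ ^ (1 - α : ℝ) * ‖x - y‖ ^ (α : ℝ) := by
  have h0 : IsSmallPert δ ρ (0 : E →ᵇ E) := isSmallPert_zero hρ
  obtain ⟨v, hv, hvC⟩ := hA.exists_isConjPair hc hρ hg h0
  obtain ⟨w, hw, hwC⟩ := hA.exists_isConjPair hc hρ h0 hg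
  have huniq : ∀ u, IsConj A g u → u = v := fun u hu =>
    hA.isConjPair_unique hc hg.1 h0.1 (isConjPair_zero_iff.2 hu) hv
  have hσ : sigma A g = v := sigma_eq (isConjPair_zero_iff.1 hv) huniq
  have hvw := hA.isConjPair_unique hc hg.1 hg.1 (hv.comp hw) (isConjPair_self g)
  have hwv := hA.isConjPair_unique hc h0.1 h0.1 (hw.comp hv) (isConjPair_self 0)
  have hinv : IsInv v w := by
    refine ⟨fun x => ?_, fun x => ?_⟩
    · have := DFunLike.congr_fun hvw x
      rw [compCorrection_apply, BoundedContinuousFunction.coe_zero, Pi.zero_apply] at this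
      rw [add_assoc, this, add_zero]
    · have := DFunLike.congr_fun hwv x
      rw [compCorrection_apply, BoundedContinuousFunction.coe_zero, Pi.zero_apply] at this
      rw [add_assoc, this, add_zero]
  have hτ : tau A g = w := tau_eq (by rwa [hσ])
  rw [hτ, hσ]
  exact ⟨fun u => ⟨huniq u, fun hu => hu ▸ isConjPair_zero_iff.1 hv⟩, hinv, hvC, hwC⟩

theorem IsAdapted.exists_dist_sigma_le (hA : IsAdapted A Es Eu)
    (hc : Admissible A Es Eu α ε δ) (hρ : 0 < ρ) :
    ∃ K : ℝ≥0, ∀ {g g' : E →ᵇ E}, IsSmallPert δ ρ g → IsSmallPert δ ρ g' →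
      ∀ {D : ℝ}, (∀ x, ‖g x - g' x‖ ≤ D) → dist (sigma A g) (sigma A g') ≤ K * D := by
  obtain ⟨K, hK⟩ := hA.exists_dist_le hc
  exact ⟨K, fun hg hg' D hD => hK hg.1 (isSmallPert_zero hρ).1
    (isConjPair_zero_iff.2 (((hA.sigma_tau_spec hc hρ hg).1 _).2 rfl))
    (isConjPair_zero_iff.2 (((hA.sigma_tau_spec hc hρ hg').1 _).2 rfl)) hD⟩

/-- The inverses vary in a Hölder way. -/
theorem IsAdapted.exists_dist_tau_le (hA : IsAdapted A Es Eu)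
    (hc : Admissible A Es Eu α ε δ) (hρ : 0 < ρ) :
    ∃ K : ℝ≥0, ∀ {g g' : E →ᵇ E}, IsSmallPert δ ρ g → IsSmallPert δ ρ g' →
      ∀ {D : ℝ}, (∀ x, ‖g x - g' x‖ ≤ D) → dist (tau A g) (tau A g') ≤ K * D ^ (α : ℝ) := by
  obtain ⟨K, hK⟩ := hA.exists_dist_sigma_le hc hρ
  -- `B` bounds the distance of any two `sigma`'s, which lets the linear term of `IsInv.dist_le` be
  -- absorbed into the `α`-th power; the summand `1` makes it positive.
  set B : ℝ := K * (2 * δ * ρ) + 1 with hB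
  have hB0 : 0 < B := by positivity
  set C : ℝ := ε * ρ ^ (1 - α : ℝ) with hC
  have hC0 : 0 ≤ C := by positivity
  refine ⟨((B ^ (1 - α : ℝ) + C) * (K : ℝ) ^ (α : ℝ)).toNNReal,
    fun {g g'} hg hg' D hD => ?_⟩
  have hD0 : 0 ≤ D := (norm_nonneg _).trans (hD 0)
  obtain ⟨-, hi, -, hH⟩ := hA.sigma_tau_spec hc hρ hg
  obtain ⟨-, hi', -, -⟩ := hA.sigma_tau_spec hc hρ hg'
  have h1 := hK hg hg' hD
  have h2 : dist (sigma A g) (sigma A g') ≤ B := by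
    have : dist (sigma A g) (sigma A g') ≤ K * (2 * δ * ρ) := hK hg hg' fun x =>
      (norm_sub_le_of_le (hg.2 x) (hg'.2 x)).trans_eq (by ring)
    linarith
  calc dist (tau A g) (tau A g')
      ≤ dist (sigma A g) (sigma A g') + C * dist (sigma A g) (sigma A g') ^ (α : ℝ) :=
        hi.dist_le hi' hC0 hH
    _ ≤ B ^ (1 - α : ℝ) * dist (sigma A g) (sigma A g') ^ (α : ℝ)
        + C * dist (sigma A g) (sigma A g') ^ (α : ℝ) := by
        gcongr
        exact le_scaled_rpow hB0 hc.exp_lt_one.le dist_nonneg h2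
    _ = (B ^ (1 - α : ℝ) + C) * dist (sigma A g) (sigma A g') ^ (α : ℝ) := by ring
    _ ≤ (B ^ (1 - α : ℝ) + C) * (K * D) ^ (α : ℝ) := by gcongr
    _ = _ := by
        rw [Real.coe_toNNReal _ (by positivity), Real.mul_rpow K.coe_nonneg hD0, mul_assoc]

end Conjugacies

/-! ### Interpolation between uniform and Hölder bounds. -/

section Interpolation

variable {E : Type*} [NormedAddCommGroup E]

theorem holderWith_of_norm_sub_le {X : Type*} [MetricSpace X] {u : X → E} {C : ℝ} {b : ℝ≥0}
    (h : ∀ x y, ‖u x - u y‖ ≤ C * dist x y ^ (b : ℝ)) : HolderWith C.toNNReal b u := fun x y => by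
  rw [edist_dist (u x), dist_eq_norm, edist_dist, ENNReal.ofReal_rpow_of_nonneg dist_nonneg b.coe_nonneg]
  change _ ≤ ENNReal.ofReal C * _
  rw [← ENNReal.ofReal_mul' (by positivity)]
  exact ENNReal.ofReal_le_ofReal (h x y)

/-- Weighted geometric mean of the `α`-Hölder bound and the trivial bound `2 D`, with weights `β /
α` and `1 - β / α`. -/
theorem norm_sub_le_interpolate {X : Type*} [MetricSpace X] {u : X → E} {C D : ℝ} {α β : ℝ≥0}
    (hα : 0 < α) (hβα : β < α) (hC : 0 ≤ C)
    (hu : ∀ x y, ‖u x - u y‖ ≤ C * dist x y ^ (α : ℝ)) (hD : ∀ x, ‖u x‖ ≤ D) (x y : X) :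
    ‖u x - u y‖ ≤ C ^ (β / α : ℝ) * (2 * D) ^ (1 - β / α : ℝ) * dist x y ^ (β : ℝ) := by
  have hα' : (0 : ℝ) < α := by exact_mod_cast hα
  have hθ1 : (0 : ℝ) < 1 - β / α := by
    rw [sub_pos, div_lt_one hα']; exact_mod_cast hβα
  have h2 : ‖u x - u y‖ ≤ 2 * D := (norm_sub_le_of_le (hD x) (hD y)).trans_eq (by ring)
  calc ‖u x - u y‖ = ‖u x - u y‖ ^ (β / α : ℝ) * ‖u x - u y‖ ^ (1 - β / α : ℝ) := by
        rw [← Real.rpow_add_of_nonneg (norm_nonneg _) (by positivity) hθ1.le,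
          add_sub_cancel, Real.rpow_one]
    _ ≤ (C * dist x y ^ (α : ℝ)) ^ (β / α : ℝ) * (2 * D) ^ (1 - β / α : ℝ) := by
        gcongr
        exact hu x y
    _ = _ := by
        rw [Real.mul_rpow hC (by positivity), ← Real.rpow_mul dist_nonneg,
          mul_div_cancel₀ _ hα'.ne']
        ring

theorem memBL_onBall {u : E →ᵇ E} {C : ℝ} {α β : ℝ≥0} (hα : 0 < α) (hβα : β < α) (hC : 0 ≤ C)
    (hu : ∀ x y, ‖u x - u y‖ ≤ C * ‖x - y‖ ^ (α : ℝ)) (t : ℝ) : MemBL β (onBall t u) :=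
  ⟨u.continuous.comp continuous_subtype_val, ⟨‖u‖, fun x => u.norm_coe_le_norm x⟩,
    (holderWith_of_norm_sub_le (norm_sub_le_interpolate (u := onBall t u) hα hβα hC
      (fun x y => by rw [Subtype.dist_eq, dist_eq_norm]; exact hu x y)
      fun x => u.norm_coe_le_norm x)).memHolder⟩

/-- The difference `u - u'` is `α`-Hölder with constant `2 C`. Since `1 - β / α > 0`, the bound
tends to `0` with `dist u u'`. -/
theorem blNorm_onBall_sub_le {u u' : E →ᵇ E} {C : ℝ} {α β : ℝ≥0} (hα : 0 < α) (hβα : β < α)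
    (hC : 0 ≤ C) (hu : ∀ x y, ‖u x - u y‖ ≤ C * ‖x - y‖ ^ (α : ℝ))
    (hu' : ∀ x y, ‖u' x - u' y‖ ≤ C * ‖x - y‖ ^ (α : ℝ)) (t : ℝ) :
    blNorm β (onBall t u - onBall t u') ≤ ENNReal.ofReal (max (dist u u')
      ((2 * C) ^ (β / α : ℝ) * (2 * dist u u') ^ (1 - β / α : ℝ))) := by
  have hD : ∀ x, ‖(onBall t u - onBall t u') x‖ ≤ dist u u' := fun x => by
    rw [Pi.sub_apply, ← dist_eq_norm]
    exact BoundedContinuousFunction.dist_coe_le_dist _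
  rw [ENNReal.ofReal_max]
  refine max_le_max (iSup_le fun x => ?_) ?_
  · rw [← ofReal_norm]
    exact ENNReal.ofReal_le_ofReal (hD x)
  · refine (holderWith_of_norm_sub_le (norm_sub_le_interpolate (C := 2 * C) hα hβα (by positivity)
      (fun x y => ?_) hD)).eHolderNorm_le
    rw [Subtype.dist_eq, dist_eq_norm]
    have : (onBall t u - onBall t u') x - (onBall t u - onBall t u') y
        = (u x - u y) - (u' x - u' y) := by
      simp only [Pi.sub_apply, onBall]; abel
    rw [this]
    exact (norm_sub_le_of_le (hu x y) (hu' x y)).trans_eq (by ring)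

/-- A Hölder map into `BC(E, E)` whose values are uniformly Hölder of exponent `α` is continuous
into the Hölder spaces of smaller exponent. -/
theorem IsHolderOn.isContOn_blNorm {X : Type*} {d : X → X → ℝ≥0∞} {a : ℝ≥0} {F : X → (E →ᵇ E)}
    {S : Set X} (hF : IsHolderOn d edist a F S) (ha : 0 < a) {C : ℝ} {α β : ℝ≥0} (hα : 0 < α)
    (hβα : β < α) (hC : 0 ≤ C)
    (hu : ∀ g ∈ S, ∀ x y, ‖F g x - F g y‖ ≤ C * ‖x - y‖ ^ (α : ℝ)) (t : ℝ) :
    IsContOn d (fun u₁ u₂ => blNorm β (u₁ - u₂)) (fun g => onBall t (F g)) S := by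
  obtain ⟨K, hK⟩ := hF
  have hα' : (0 : ℝ) < α := by exact_mod_cast hα
  have ha' : (0 : ℝ) < a := by exact_mod_cast ha
  have hθ1 : (0 : ℝ) < 1 - β / α := by
    rw [sub_pos, div_lt_one hα']; exact_mod_cast hβα
  intro g hg e he
  let φ : ℝ≥0∞ → ℝ≥0∞ := fun x => ENNReal.ofReal (max (K * x ^ (a : ℝ)).toReal
    ((2 * C) ^ (β / α : ℝ) * (2 * (K * x ^ (a : ℝ)).toReal) ^ (1 - β / α : ℝ)))
  have hx : Filter.Tendsto (fun x : ℝ≥0∞ => K * x ^ (a : ℝ)) (𝓝 0) (𝓝 0) := by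
    have := ENNReal.Tendsto.const_mul (a := (K : ℝ≥0∞))
      ((ENNReal.continuous_rpow_const (y := (a : ℝ))).tendsto 0) (Or.inr ENNReal.coe_ne_top)
    rwa [ENNReal.zero_rpow_of_pos ha', mul_zero] at this
  have hr : Filter.Tendsto (fun x : ℝ≥0∞ => (K * x ^ (a : ℝ)).toReal) (𝓝 0) (𝓝 0) := by
    have := (ENNReal.tendsto_toReal ENNReal.zero_ne_top).comp hx
    rwa [ENNReal.toReal_zero] at this
  have hφ : Filter.Tendsto φ (𝓝 0) (𝓝 0) := by
    have h1 := ((hr.const_mul 2).rpow_const (p := (1 - β / α : ℝ)) (Or.inr hθ1.le)).const_mul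
      ((2 * C) ^ (β / α : ℝ))
    have h2 := ENNReal.tendsto_ofReal (hr.max h1)
    rwa [mul_zero, Real.zero_rpow hθ1.ne', mul_zero, max_self, ENNReal.ofReal_zero] at h2
  -- The second condition keeps the Hölder bound finite, as needed for the comparison through
  -- `toReal`.
  have hev := (hφ.eventually_lt_const he).and (hx.eventually_lt_const (ENNReal.zero_lt_top))
  obtain ⟨η, hη, hηe⟩ := ENNReal.nhds_zero_basis.eventually_iff.1 hev
  refine ⟨η, hη, fun h hh hgh => ?_⟩
  obtain ⟨h1, h2⟩ := hηe (Set.mem_Iio.2 hgh)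
  refine (blNorm_onBall_sub_le hα hβα hC (hu g hg) (hu h hh) t).trans_lt (lt_of_le_of_lt ?_ h1)
  have h3 : dist (F g) (F h) ≤ (K * d g h ^ (a : ℝ)).toReal := by
    have := ENNReal.toReal_mono h2.ne (hK g hg h hh)
    rwa [edist_dist, ENNReal.toReal_ofReal dist_nonneg] at this
  refine ENNReal.ofReal_le_ofReal (max_le_max h3 ?_)
  gcongr

end Interpolation

/-! ### Lipschitz estimates for the cut-off nonlinearity. -/

section Cutoff

variable {𝕜 E : Type*} [NontriviallyNormedField 𝕜] [NormedAddCommGroup E] [NormedSpace 𝕜 E]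
  {δ L : ℝ≥0} {r : ℝ} {ξ : E → 𝕜} {R R' : Metric.ball (0 : E) r → E}

theorem lipBound_le : lipBound 𝕜 δ L ≤ δ := by
  unfold lipBound
  split_ifs
  · exact le_rfl
  · exact div_le_self zero_le (le_add_of_nonneg_right zero_le)

theorem lipBound_pos (hδ : 0 < δ) : 0 < lipBound 𝕜 δ L := by
  unfold lipBound
  split_ifs
  · exact hδ
  · positivity

theorem norm_le_of_lipschitzWith (hr : 0 < r) (hR : LipschitzWith δ R)
    (h0 : R ⟨0, Metric.mem_ball_self hr⟩ = 0) (x : Metric.ball (0 : E) r) :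
    ‖R x‖ ≤ δ * ‖(x : E)‖ := by
  have := hR.dist_le_mul x ⟨0, Metric.mem_ball_self hr⟩
  rwa [h0, dist_zero_right, Subtype.dist_eq, dist_zero_right] at this

theorem norm_cutExtend_sub_le (hξ : ¬ IsUltrametricDist 𝕜 → IsCutoff (r / 3) L ξ) {D : ℝ}
    (hD0 : 0 ≤ D) (hD : ∀ x, ‖R x - R' x‖ ≤ D) (y : E) :
    ‖cutExtend r ξ R y - cutExtend r ξ R' y‖ ≤ D := by
  unfold cutExtend
  split_ifs with hy hu
  · exact hD _
  · rw [← smul_sub, norm_smul]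
    exact (mul_le_of_le_one_left (norm_nonneg _) ((hξ hu).norm_le_one y)).trans (hD _)
  · simpa using hD0

theorem norm_cutExtend_le (hξ : ¬ IsUltrametricDist 𝕜 → IsCutoff (r / 3) L ξ) {D : ℝ}
    (hD0 : 0 ≤ D) (hD : ∀ x, ‖R x‖ ≤ D) (y : E) : ‖cutExtend r ξ R y‖ ≤ D := by
  have h := norm_cutExtend_sub_le (R' := fun _ => 0) hξ hD0 (by simpa using hD) y
  have h0 : cutExtend r ξ (fun _ => 0) y = 0 := by
    unfold cutExtend; split_ifs <;> simp
  rwa [h0, sub_zero] at h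

/-- Over an ultrametric field, a point outside the ball is at least `‖x‖` away from any `x` inside,
so extension by zero costs nothing. Otherwise the product rule gives at most `c (1 + 2 L) ≤ c (1 + 3
L) = δ`, where `c` is the Lipschitz constant of `R`. -/
theorem lipschitzWith_cutExtend (hE : IsUltrametricDist 𝕜 → IsUltrametricDist E) (hr : 0 < r)
    (hξ : ¬ IsUltrametricDist 𝕜 → IsCutoff (r / 3) L ξ) (hR : LipschitzWith (lipBound 𝕜 δ L) R)
    (h0 : R ⟨0, Metric.mem_ball_self hr⟩ = 0) : LipschitzWith δ (cutExtend r ξ R) := by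
  have hn := norm_le_of_lipschitzWith hr hR h0
  refine LipschitzWith.of_dist_le_mul fun x y => ?_
  -- With `x` the point of smaller norm, `R` has to be bounded in size at `x` only.
  wlog hxy : ‖x‖ ≤ ‖y‖ generalizing x y
  · rw [dist_comm, dist_comm x]
    exact this y x (le_of_not_ge hxy)
  rw [dist_eq_norm, dist_eq_norm]
  by_cases hx : x ∈ Metric.ball (0 : E) r
  swap
  · have hy : y ∉ Metric.ball (0 : E) r := fun h => hx (by
      rw [mem_ball_zero_iff] at h ⊢; exact hxy.trans_lt h)
    simp only [cutExtend, dif_neg hx, dif_neg hy, sub_self, norm_zero]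
    positivity
  have hxr : ‖x‖ < r := by rwa [mem_ball_zero_iff] at hx
  by_cases hu : IsUltrametricDist 𝕜
  · have hl : lipBound 𝕜 δ L = δ := by simp [lipBound, hu]
    rw [hl] at hn hR
    have hxv : cutExtend r ξ R x = R ⟨x, hx⟩ := by rw [cutExtend, dif_pos hx, if_pos hu]
    by_cases hy : y ∈ Metric.ball (0 : E) r
    · have hyv : cutExtend r ξ R y = R ⟨y, hy⟩ := by rw [cutExtend, dif_pos hy, if_pos hu]
      rw [hxv, hyv]
      have := hR.dist_le_mul ⟨x, hx⟩ ⟨y, hy⟩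
      rwa [dist_eq_norm, Subtype.dist_eq, dist_eq_norm] at this
    · have hyv : cutExtend r ξ R y = 0 := by rw [cutExtend, dif_neg hy]
      rw [hxv, hyv, sub_zero]
      refine (hn _).trans (mul_le_mul_of_nonneg_left ?_ δ.coe_nonneg)
      rw [mem_ball_zero_iff, not_lt] at hy
      have := hE hu
      have h1 := dist_triangle_max (0 : E) x y
      rw [dist_zero_left, dist_zero_left, dist_eq_norm] at h1
      rcases le_max_iff.1 h1 with h | h
      · linarith
      · exact hxy.trans h
  · have hξ := hξ hu
    set c := lipBound 𝕜 δ L with hc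
    have hcL : (c : ℝ) * (1 + 3 * L) = δ := by
      have : c * (1 + 3 * L) = δ := by
        rw [hc, lipBound, if_neg hu, div_mul_cancel₀]; positivity
      exact_mod_cast this
    have hc0 := c.2
    have hL0 := L.2
    have hxv : cutExtend r ξ R x = ξ x • R ⟨x, hx⟩ := by
      rw [cutExtend, dif_pos hx, if_neg hu]
    have hlip : ‖ξ x - ξ y‖ ≤ L / (r / 3) * ‖x - y‖ := hξ.lipschitz x y
    rcases le_total (2 * (r / 3)) ‖x‖ with h2 | h2
    · have hyv : cutExtend r ξ R y = 0 := by
        unfold cutExtend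
        split_ifs
        · rw [hξ.eq_zero y (h2.trans hxy), zero_smul]
        · rfl
      rw [hxv, hyv, hξ.eq_zero x h2, zero_smul, sub_zero, norm_zero]
      positivity
    · have hRx : ‖R ⟨x, hx⟩‖ ≤ c * (2 * (r / 3)) := (hn _).trans (by gcongr)
      -- The slope `3 L / r` of `ξ` meets `‖R x‖ ≤ 2 c r / 3`, so the radius cancels.
      have h1 : ‖(ξ x - ξ y) • R ⟨x, hx⟩‖ ≤ 2 * c * L * ‖x - y‖ := by
        rw [norm_smul]
        calc _ ≤ (L / (r / 3) * ‖x - y‖) * (c * (2 * (r / 3))) := by gcongr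
          _ = _ := by field_simp
      by_cases hy : y ∈ Metric.ball (0 : E) r
      · have hyv : cutExtend r ξ R y = ξ y • R ⟨y, hy⟩ := by
          rw [cutExtend, dif_pos hy, if_neg hu]
        have h3 : ‖ξ y • (R ⟨x, hx⟩ - R ⟨y, hy⟩)‖ ≤ c * ‖x - y‖ := by
          rw [norm_smul]
          refine (mul_le_of_le_one_left (norm_nonneg _) (hξ.norm_le_one y)).trans ?_
          have := hR.dist_le_mul ⟨x, hx⟩ ⟨y, hy⟩
          rwa [dist_eq_norm, Subtype.dist_eq, dist_eq_norm] at this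
        rw [hxv, hyv]
        have : ξ x • R ⟨x, hx⟩ - ξ y • R ⟨y, hy⟩
            = (ξ x - ξ y) • R ⟨x, hx⟩ + ξ y • (R ⟨x, hx⟩ - R ⟨y, hy⟩) := by
          rw [sub_smul, smul_sub]; abel
        rw [this]
        refine (norm_add_le_of_le h1 h3).trans ?_
        rw [← hcL]
        have : 0 ≤ c * L * ‖x - y‖ := by positivity
        linarith
      · have hyv : cutExtend r ξ R y = 0 := by rw [cutExtend, dif_neg hy]
        -- Thus `h1` alone is already the required estimate when `y` leaves the ball.
        have hy2 : ξ y = 0 := by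
          rw [mem_ball_zero_iff, not_lt] at hy
          exact hξ.eq_zero y (by linarith)
        rw [hy2, sub_zero] at h1
        rw [hxv, hyv, sub_zero]
        refine h1.trans ?_
        rw [← hcL]
        have : 0 ≤ c * L * ‖x - y‖ := by positivity
        have : 0 ≤ c * ‖x - y‖ := by positivity
        linarith

end Cutoff

/-! ### Difference quotients and the neighbourhood `Omega`. -/

section Neighbourhood

variable {𝕜 E : Type*} [NontriviallyNormedField 𝕜] [NormedAddCommGroup E] [NormedSpace 𝕜 E]

theorem C1Map.dq_apply {U : Set E} (f : C1Map 𝕜 U) (p : dqDomain 𝕜 U) (hp : p.1.2.2 ≠ 0) :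
    f.dq p = p.1.2.2⁻¹ • (f.toMap ⟨p.1.1 + p.1.2.2 • p.1.2.1, p.2.2⟩ - f.toMap ⟨p.1.1, p.2.1⟩) :=
  f.exists_dq.choose_spec p hp

/-- `0` is not isolated in `𝕜` and `U` is open, so `t` can be moved off `0`. The values at `t ≠ 0`
therefore determine the continuous extension. -/
theorem mem_closure_dqDomain_ne_zero {U : Set E} (hU : IsOpen U) (p : dqDomain 𝕜 U) :
    p ∈ closure {p : dqDomain 𝕜 U | p.1.2.2 ≠ 0} := by
  by_cases hp : p.1.2.2 ≠ 0
  · exact subset_closure hp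
  rw [not_not] at hp
  rw [closure_subtype]
  obtain ⟨⟨x, y, t⟩, hx, hxy⟩ := p
  obtain rfl : t = 0 := hp
  have h1 : Filter.Tendsto (fun t : 𝕜 => (x, y, t)) (𝓝[≠] 0) (𝓝 (x, y, 0)) :=
    (Continuous.tendsto (by fun_prop) 0).mono_left nhdsWithin_le_nhds
  have h2 : ∀ᶠ t : 𝕜 in 𝓝[≠] 0, x + t • y ∈ U :=
    nhdsWithin_le_nhds ((Continuous.tendsto (by fun_prop : Continuous fun t : 𝕜 => x + t • y) 0)
      (hU.mem_nhds hxy))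
  refine mem_closure_of_tendsto h1 ?_
  filter_upwards [h2, self_mem_nhdsWithin] with t ht ht0
  exact ⟨⟨(x, y, t), hx, ht⟩, ht0, rfl⟩

/-- `dq` is obtained by choice, so even for the zero map its values at `t = 0` need the density
argument. -/
theorem C1Map.dq_zero {U : Set E} (hU : IsOpen U) : (0 : C1Map 𝕜 U).dq = 0 := by
  ext p
  have hcl : IsClosed {p : dqDomain 𝕜 U | (0 : C1Map 𝕜 U).dq p = 0} :=
    isClosed_eq (map_continuous _) continuous_const
  refine closure_minimal (fun p hp => ?_) hcl (mem_closure_dqDomain_ne_zero hU p)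
  rw [Set.mem_ofPred_eq, C1Map.dq_apply _ _ hp]
  change _ • ((0 : E) - 0) = 0
  simp

/-- Requiring both endpoints to lie in `K`, not merely in `P`, makes the set closed in the ambient
product; no convexity of `K` is involved. -/
theorem isCompact_dqDomain_preimage [LocallyCompactSpace 𝕜] [ProperSpace E] {K P : Set E}
    (hK : IsCompact K) (hKP : K ⊆ P) (T : ℝ) :
    IsCompact {p : dqDomain 𝕜 P |
      p.1.1 ∈ K ∧ p.1.1 + p.1.2.2 • p.1.2.1 ∈ K ∧ ‖p.1.2.1‖ ≤ 1 ∧ ‖p.1.2.2‖ ≤ T} := by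
  have := ProperSpace.of_locallyCompactSpace 𝕜 (E := 𝕜)
  rw [Subtype.isCompact_iff]
  have himg : (Subtype.val '' {p : dqDomain 𝕜 P |
      p.1.1 ∈ K ∧ p.1.1 + p.1.2.2 • p.1.2.1 ∈ K ∧ ‖p.1.2.1‖ ≤ 1 ∧ ‖p.1.2.2‖ ≤ T})
      = (K ×ˢ Metric.closedBall (0 : E) 1 ×ˢ Metric.closedBall (0 : 𝕜) T)
        ∩ {p : E × E × 𝕜 | p.1 + p.2.2 • p.2.1 ∈ K} := by
    ext p
    constructor
    · rintro ⟨p, ⟨h1, h2, h3, h4⟩, rfl⟩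
      exact ⟨⟨h1, mem_closedBall_zero_iff.2 h3, mem_closedBall_zero_iff.2 h4⟩, h2⟩
    · rintro ⟨⟨h1, h3, h4⟩, h2⟩
      exact ⟨⟨p, hKP h1, hKP h2⟩,
        ⟨h1, h2, mem_closedBall_zero_iff.1 h3, mem_closedBall_zero_iff.1 h4⟩, rfl⟩
  rw [himg]
  exact (hK.prod ((isCompact_closedBall _ _).prod (isCompact_closedBall _ _))).inter_right
    (hK.isClosed.preimage (by fun_prop))

/-- Maps close to `0` in the compact-open `C¹`-topology have small Lipschitz constants on compact
sets. -/
theorem eventually_lipschitzOnWith [LocallyCompactSpace 𝕜] [ProperSpace E] {K P : Set E}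
    (hK : IsCompact K) (hP : IsOpen P) (hKP : K ⊆ P) {c : ℝ≥0} (hc : 0 < c) :
    ∀ᶠ g in 𝓝 (0 : C1Map 𝕜 P), ∀ x y : P, (x : E) ∈ K → (y : E) ∈ K →
      ‖g.toMap x - g.toMap y‖ ≤ c * ‖(x : E) - y‖ := by
  obtain ⟨a, ha⟩ := NormedField.exists_one_lt_norm 𝕜
  have ha0 : 0 < ‖a‖ := zero_lt_one.trans ha
  obtain ⟨B, hB⟩ := hK.isBounded.exists_norm_le
  have hS := isCompact_dqDomain_preimage (𝕜 := 𝕜) hK hKP (‖a‖ * (B + B))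
  set S := {p : dqDomain 𝕜 P | p.1.1 ∈ K ∧ p.1.1 + p.1.2.2 • p.1.2.1 ∈ K ∧ ‖p.1.2.1‖ ≤ 1 ∧
    ‖p.1.2.2‖ ≤ ‖a‖ * (B + B)} with hSdef
  have hdq : Continuous (C1Map.dq : C1Map 𝕜 P → C(dqDomain 𝕜 P, E)) :=
    continuous_iff_le_induced.2 inf_le_right
  have hη : 0 < c / ‖a‖ := by positivity
  have hopen := (ContinuousMap.isOpen_setOfPred_mapsTo hS
    (Metric.isOpen_ball (x := (0 : E)) (ε := c / ‖a‖))).preimage hdq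
  filter_upwards [hopen.mem_nhds (by
    intro p _
    rw [C1Map.dq_zero hP]
    exact Metric.mem_ball_self hη)] with g hg x y hx hy
  rcases eq_or_ne x y with rfl | hxy
  · simp
  have hxy' : (y : E) - x ≠ 0 := sub_ne_zero.2 fun h => hxy (Subtype.ext h.symm)
  -- Vectors need not be normalizable by scalars, so `y - x` is only scaled into a shell below norm
  -- `1`. Then `t = d⁻¹` has norm at most `‖a‖ ‖y - x‖`, and the lost factor `‖a‖` is recovered from
  -- the threshold `c / ‖a‖`.
  obtain ⟨d, hd0, hd1, -, hd2⟩ := rescale_to_shell ha one_pos hxy'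
  rw [inv_one, one_mul, ← norm_inv] at hd2
  have hsm : (x : E) + d⁻¹ • d • ((y : E) - x) = y := by
    rw [inv_smul_smul₀ hd0, add_sub_cancel]
  let p : dqDomain 𝕜 P := ⟨(x, d • ((y : E) - x), d⁻¹), x.2, by
    change (x : E) + d⁻¹ • d • ((y : E) - x) ∈ P
    rw [hsm]; exact y.2⟩
  have hp : p ∈ S := by
    refine ⟨hx, ?_, hd1.le, hd2.trans ?_⟩
    · change (x : E) + d⁻¹ • d • ((y : E) - x) ∈ K
      rw [hsm]; exact hy
    · exact mul_le_mul_of_nonneg_left (norm_sub_le_of_le (hB _ hy) (hB _ hx)) ha0.le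
  have h1 : ‖g.dq p‖ ≤ c / ‖a‖ := (mem_ball_zero_iff.1 (hg hp)).le
  have h2 : g.dq p = d • (g.toMap y - g.toMap x) := by
    rw [C1Map.dq_apply g p (inv_ne_zero hd0)]
    have e : (⟨p.1.1 + p.1.2.2 • p.1.2.1, p.2.2⟩ : P) = y := Subtype.ext hsm
    rw [e]
    change d⁻¹⁻¹ • _ = _
    rw [inv_inv]
  have h3 : ‖g.toMap y - g.toMap x‖ = ‖d⁻¹‖ * ‖g.dq p‖ := by
    rw [h2, ← norm_smul, inv_smul_smul₀ hd0]
  rw [norm_sub_rev, h3, norm_sub_rev]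
  calc ‖d⁻¹‖ * ‖g.dq p‖ ≤ (‖a‖ * ‖(y : E) - x‖) * (c / ‖a‖) := by gcongr
    _ = c * ‖(y : E) - x‖ := by field_simp

variable {A : E ≃L[𝕜] E} {P : Set E} {h0 : (0 : E) ∈ P} {r : ℝ}

theorem remainder_addLinear (hK : Metric.ball (0 : E) r ⊆ P) (g : C1Zero 𝕜 P h0) :
    remainder A (addLinear A hK g) = restrictBall hK g := by
  funext x
  simp [remainder, addLinear]

/-- The conditions at `0` are inherited from `C1Zero` by restriction to the ball, so only the
Lipschitz condition remains. -/
theorem mem_Omega_iff {δ L : ℝ≥0} (hr : 0 < r) (hK : Metric.ball (0 : E) r ⊆ P)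
    (g : C1Zero 𝕜 P h0) :
    g ∈ Omega A δ L h0 hr hK ↔ LipschitzWith (lipBound 𝕜 δ L) (restrictBall hK g) := by
  rw [← remainder_addLinear (A := A)]
  refine ⟨fun h => h.2.2, fun h => ⟨?_, ?_, h⟩⟩
  · have hg := g.2.2
    unfold HasStrictDeriv at hg ⊢
    let i : Metric.ball (0 : E) r → P := fun x => ⟨x, hK x.2⟩
    have hi : Continuous i := by fun_prop
    have ht : Filter.Tendsto (Prod.map i i)
        (𝓝 (⟨0, Metric.mem_ball_self hr⟩, ⟨0, Metric.mem_ball_self hr⟩)) (𝓝 (⟨0, h0⟩, ⟨0, h0⟩)) :=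
      (hi.prodMap hi).tendsto _
    refine (hg.comp_tendsto ht).congr (fun p => ?_) fun p => rfl
    simp [addLinear, restrictBall, i]
    abel
  · have := g.2.1
    simp [addLinear, restrictBall, this]

theorem Omega_mem_nhds [LocallyCompactSpace 𝕜] [ProperSpace E] {δ L : ℝ≥0} (hδ : 0 < δ)
    (hP : IsOpen P) (hr : 0 < r) (hrP : closure (Metric.ball (0 : E) r) ⊆ P) :
    Omega A δ L h0 hr (subset_closure.trans hrP) ∈ 𝓝 (0 : C1Zero 𝕜 P h0) := by
  have hcomp : IsCompact (closure (Metric.ball (0 : E) r)) := Metric.isBounded_ball.isCompact_closure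
  have := (continuous_subtype_val.tendsto (0 : C1Zero 𝕜 P h0)).eventually
    (eventually_lipschitzOnWith (𝕜 := 𝕜) hcomp hP hrP (lipBound_pos (𝕜 := 𝕜) (L := L) hδ))
  filter_upwards [this] with g hg
  rw [mem_Omega_iff]
  refine LipschitzWith.of_dist_le_mul fun x y => ?_
  rw [dist_eq_norm, Subtype.dist_eq, dist_eq_norm]
  exact hg _ _ (subset_closure x.2) (subset_closure y.2)

end Neighbourhood

/-! ### Transfer of the estimates to `Omega`. -/

section Main

variable {𝕜 E : Type*} [NontriviallyNormedField 𝕜] [NormedAddCommGroup E] [NormedSpace 𝕜 E]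
  {δ L : ℝ≥0} {r : ℝ} {ξ : E → 𝕜}

theorem exists_isSmallPert_coe_eq_cutExtend (hE : IsUltrametricDist 𝕜 → IsUltrametricDist E)
    (hr : 0 < r) (hξ : ¬ IsUltrametricDist 𝕜 → IsCutoff (r / 3) L ξ)
    {R : Metric.ball (0 : E) r → E} (hR : LipschitzWith (lipBound 𝕜 δ L) R)
    (h0 : R ⟨0, Metric.mem_ball_self hr⟩ = 0) :
    ∃ G : E →ᵇ E, ⇑G = cutExtend r ξ R ∧ IsSmallPert δ r G := by
  have hL := lipschitzWith_cutExtend hE hr hξ hR h0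
  have hb : ∀ y, ‖cutExtend r ξ R y‖ ≤ δ * r := norm_cutExtend_le hξ (by positivity) fun x => by
    refine (norm_le_of_lipschitzWith hr (hR.weaken lipBound_le) h0 x).trans ?_
    gcongr
    exact (mem_ball_zero_iff.1 x.2).le
  exact ⟨BoundedContinuousFunction.ofNormedAddCommGroup _ hL.continuous _ hb, rfl, hL, hb⟩

variable {P : Set E} {h0 : (0 : E) ∈ P} {A : E ≃L[𝕜] E}

theorem norm_restrictBall_sub_le_toReal_dK (hK : Metric.ball (0 : E) r ⊆ P) {g h : C1Zero 𝕜 P h0}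
    (hgh : dK hK g h ≠ ⊤) (x : Metric.ball (0 : E) r) :
    ‖restrictBall hK g x - restrictBall hK h x‖ ≤ (dK hK g h).toReal := by
  rw [← dist_eq_norm, ← ENNReal.ofReal_le_iff_le_toReal hgh, ← edist_dist]
  exact le_iSup (fun x => edist (restrictBall hK g x) (restrictBall hK h x)) x

/-- Needed to pass from real estimates to the extended distance: nonlinearities in `Omega` are
bounded by `δ r` on the ball. -/
theorem dK_ne_top (hK : Metric.ball (0 : E) r ⊆ P) (hr : 0 < r) {g h : C1Zero 𝕜 P h0}
    (hg : g ∈ Omega A δ L h0 hr hK) (hh : h ∈ Omega A δ L h0 hr hK) : dK hK g h ≠ ⊤ := by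
  have hb : ∀ g ∈ Omega A δ L h0 hr hK, ∀ x, ‖restrictBall hK g x‖ ≤ δ * r := fun g hg x => by
    refine (norm_le_of_lipschitzWith hr (((mem_Omega_iff hr hK g).1 hg).weaken lipBound_le)
      g.2.1 x).trans ?_
    gcongr
    exact (mem_ball_zero_iff.1 x.2).le
  refine ne_top_of_le_ne_top (ENNReal.ofReal_ne_top (r := δ * r + δ * r)) (iSup_le fun x => ?_)
  rw [edist_dist, dist_eq_norm]
  exact ENNReal.ofReal_le_ofReal (norm_sub_le_of_le (hb g hg x) (hb h hh x))

/-- A real Hölder estimate for maps depending on the cut-off nonlinearity gives a Hölder estimate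
on `Omega`. -/
theorem isHolderOn_Omega (hE : IsUltrametricDist 𝕜 → IsUltrametricDist E)
    (hr : 0 < r) (hξ : ¬ IsUltrametricDist 𝕜 → IsCutoff (r / 3) L ξ)
    (hK : Metric.ball (0 : E) r ⊆ P) {F : (E → E) → (E →ᵇ E)} {a K : ℝ≥0}
    (hF : ∀ {g g' : E →ᵇ E}, IsSmallPert δ r g → IsSmallPert δ r g' →
      ∀ {D : ℝ}, (∀ x, ‖g x - g' x‖ ≤ D) → dist (F g) (F g') ≤ K * D ^ (a : ℝ)) :
    IsHolderOn (dK hK) edist a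
      (fun g : C1Zero 𝕜 P h0 => F (cutExtend r ξ (remainder A (addLinear A hK g))))
      (Omega A δ L h0 hr hK) := by
  refine ⟨K, fun g hg h hh => ?_⟩
  have htop := dK_ne_top hK hr hg hh
  have hD := norm_restrictBall_sub_le_toReal_dK hK htop
  simp only [remainder_addLinear]
  obtain ⟨G, hG, hGs⟩ := exists_isSmallPert_coe_eq_cutExtend hE hr hξ
    ((mem_Omega_iff hr hK g).1 hg) g.2.1
  obtain ⟨H, hH, hHs⟩ := exists_isSmallPert_coe_eq_cutExtend hE hr hξ
    ((mem_Omega_iff hr hK h).1 hh) h.2.1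
  have h1 := hF hGs hHs (D := (dK hK g h).toReal) (by
    rw [hG, hH]
    exact norm_cutExtend_sub_le hξ ENNReal.toReal_nonneg hD)
  rw [← hG, ← hH, edist_dist]
  refine (ENNReal.ofReal_le_ofReal h1).trans_eq ?_
  rw [ENNReal.ofReal_mul K.coe_nonneg, ENNReal.ofReal_coe_nnreal,
    ← ENNReal.ofReal_rpow_of_nonneg ENNReal.toReal_nonneg a.coe_nonneg, ENNReal.ofReal_toReal htop]

end Main

end GrobmanHartman

open GrobmanHartman in
theorem proposition7p12
    {𝕜 E : Type*} [NontriviallyNormedField 𝕜] [LocallyCompactSpace 𝕜]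
    (hC : ¬ ∃ e : 𝕜 ≃+* ℂ, Continuous e ∧ Continuous e.symm)
    [NormedAddCommGroup E] [NormedSpace 𝕜 E] [FiniteDimensional 𝕜 E]
    (hE : IsUltrametricDist 𝕜 → IsUltrametricDist E)
    (A : E ≃L[𝕜] E) (Es Eu : Submodule 𝕜 E) (hA : IsAdapted A Es Eu)
    (α ε δ : ℝ≥0) (hconst : Admissible A Es Eu α ε δ)
    (P : Set E) (hP : IsOpen P) (h0 : (0 : E) ∈ P)
    (r : ℝ) (hr : 0 < r) (hrP : closure (Metric.ball (0 : E) r) ⊆ P)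
    (L : ℝ≥0) (ξ : E → 𝕜) (hξ : ¬ IsUltrametricDist 𝕜 → IsCutoff (r / 3) L ξ) :
    let hK : Metric.ball (0 : E) r ⊆ P := subset_closure.trans hrP
    let Ω : Set (C1Zero 𝕜 P h0) := Omega A δ L h0 hr hK
    let Λ : C1Zero 𝕜 P h0 → (Metric.ball (0 : E) r → E) := addLinear A hK
    let v : C1Zero 𝕜 P h0 → (E →ᵇ E) := fun g => sigmaTilde A ξ (Λ g)
    let w : C1Zero 𝕜 P h0 → (E →ᵇ E) := fun g => tauTilde A ξ (Λ g)
    -- `Ω` is a neighbourhood of `0` in the compact-open `C¹`-topology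
    Ω ∈ 𝓝 (0 : C1Zero 𝕜 P h0) ∧
    -- the conjugacies are well defined on `Ω`
    (∀ g ∈ Ω,
      (∀ u : E →ᵇ E, IsConj A (cutExtend r ξ (remainder A (Λ g))) u ↔ u = v g) ∧
      IsInv (v g) (w g)) ∧
    -- `Λ` is Lipschitz with constant `1`
    (∀ g ∈ Ω, Λ g ∈ tildeOmega A δ L hr) ∧
    (∀ g ∈ Ω, ∀ h ∈ Ω, supEDist (Λ g) (Λ h) ≤ dK hK g h) ∧
    -- Lipschitz and Hölder dependence in `BC(E, E)`
    IsHolderOn (dK hK) edist 1 v Ω ∧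
    IsHolderOn (dK hK) edist α w Ω ∧
    -- continuous dependence in the Hölder spaces `BL_β(B_t(0), E)`
    ∀ t : ℝ, 0 < t → ∀ β : ℝ≥0, 0 < β → β < α →
      (∀ g ∈ Ω, MemBL β (onBall t (v g)) ∧ MemBL β (onBall t (w g))) ∧
      IsContOn (dK hK) (fun u₁ u₂ => blNorm β (u₁ - u₂)) (fun g => onBall t (v g)) Ω ∧
      IsContOn (dK hK) (fun u₁ u₂ => blNorm β (u₁ - u₂)) (fun g => onBall t (w g)) Ω := by
  intro hK Ω Λ v w
  have := ProperSpace.of_locallyCompactSpace 𝕜 (E := 𝕜)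
  have := FiniteDimensional.proper 𝕜 E
  have spec : ∀ g ∈ Ω,
      (∀ u, GrobmanHartman.IsConj A (cutExtend r ξ (remainder A (Λ g))) u ↔ u = v g) ∧
      IsInv (v g) (w g) ∧
      (∀ x y, ‖v g x - v g y‖ ≤ ε * r ^ (1 - α : ℝ) * ‖x - y‖ ^ (α : ℝ)) ∧
      ∀ x y, ‖w g x - w g y‖ ≤ ε * r ^ (1 - α : ℝ) * ‖x - y‖ ^ (α : ℝ) := fun g hg => by
    obtain ⟨G, hG, hGs⟩ := exists_isSmallPert_coe_eq_cutExtend hE hr hξ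
      ((mem_Omega_iff hr hK g).1 hg) g.2.1
    have := hA.sigma_tau_spec hconst hr hGs
    rwa [hG, ← remainder_addLinear (A := A)] at this
  have hC0 : (0 : ℝ) ≤ ε * r ^ (1 - α : ℝ) := by positivity
  obtain ⟨K₁, hK₁⟩ := hA.exists_dist_sigma_le hconst hr
  obtain ⟨K₂, hK₂⟩ := hA.exists_dist_tau_le hconst hr
  have hv : IsHolderOn (dK hK) edist 1 v Ω := isHolderOn_Omega (K := K₁) hE hr hξ hK
    fun hg hg' D hD => by
      rw [NNReal.coe_one, Real.rpow_one]
      exact hK₁ hg hg' hD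
  have hw : IsHolderOn (dK hK) edist α w Ω := isHolderOn_Omega hE hr hξ hK hK₂
  refine ⟨Omega_mem_nhds hconst.delta_pos hP hr hrP,
    fun g hg => ⟨(spec g hg).1, (spec g hg).2.1⟩, fun g hg => hg,
    fun g _ h _ => iSup_le fun x => ?_, hv, hw,
    fun t _ β _ hβα => ⟨fun g hg => ⟨?_, ?_⟩, ?_, ?_⟩⟩
  · refine le_trans (le_of_eq ?_) (le_iSup _ x)
    exact edist_add_left _ _ _
  · exact memBL_onBall hconst.exp_pos hβα hC0 (spec g hg).2.2.1 t
  · exact memBL_onBall hconst.exp_pos hβα hC0 (spec g hg).2.2.2 t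
  · exact hv.isContOn_blNorm one_pos hconst.exp_pos hβα hC0 (fun g hg => (spec g hg).2.2.1) t
  · exact hw.isContOn_blNorm hconst.exp_pos hconst.exp_pos hβα hC0
      (fun g hg => (spec g hg).2.2.2) t
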